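/- **Definitions.** Let $(X,d)$ be a metric space. A *geodesic* is a continuous map $c\colon[0,1]\to X$ with $d(c(s),c(t))=|s-t|\,d(c(0),c(1))$ for all $s,t$. A *geodesic bicombing* on $X$ is a map $\tau\colon X\times X\times[0,1]\to X$ such that each $\tau_{xy}:=\tau(x,y,\cdot)$ is a geodesic from $x$ to $y$, and $\tau_{pq}([0,1])\subset\tau_{xy}([0,1])$ whenever $p,q\in\tau_{xy}([0,1])$ and $d(x,p)\le d(x,q)$. It is *convex* if $t\mapsto d(\tau_{xy}(t),\tau_{\bar x\bar y}(t))$ is convex on $[0,1]$ for all $x,y,\bar x,\bar y\in X$, and *reversible* if $\tau_{yx}([0,1])=\tau_{xy}([0,1])$ for all $x,y\in X$. A *local geodesic bicombing* $\sigma$ on $X$ consists of radii $r_x>0$ $(x\in X)$ and, with $U(x,r):=\{y\in X: d(x,y)<r\}$ and $U:=\{(y,z)\in X\times X: y,z\in U(x,r_x)\text{ for some }x\in X\}$, of a geodesic $\sigma_{yz}\colon[0,1]\to X$ from $y$ to $z$ for each $(y,z)\in U$, such that $\sigma_{yz}([0,1])\subset U(x,r_x)$ whenever $y,z\in U(x,r_x)$,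 and $\sigma_{\sigma_{yz}(a)\sigma_{yz}(b)}(t)=\sigma_{yz}((1-t)a+tb)$ for all $(y,z)\in U$, $0\le a\le b\le1$ and $t\in[0,1]$. It is *convex* if, for every $x\in X$ and all $y,z,y',z'\in U(x,r_x)$, the function $t\mapsto d(\sigma_{yz}(t),\sigma_{y'z'}(t))$ is convex on $[0,1]$, and *reversible* if $\sigma_{zy}(t)=\sigma_{yz}(1-t)$ for all $(y,z)\in U$ and $t\in[0,1]$. A map $c\colon[0,1]\to X$ is *consistent with* $\sigma$ if $c((1-t)a+tb)=\sigma_{c(a)c(b)}(t)$ for all $t\in[0,1]$ and all $0\le a\le b\le1$ with $(c(a),c(b))\in U$. A map $\tau\colon X\times X\times[0,1]\to X$ is *consistent with* $\sigma$ if every $\tau_{xy}$ is. The *induced length metric* is $\bar d(x,y):=\inf L(\gamma)$, the infimum over all continuous $\gamma\colon[0,1]\to X$ with $\gamma(0)=x$ and $\gamma(1)=y$, where $L(\gamma)$ is the supremum of $\sum_{k=1}^n d(\gamma(t_{k-1}),\gamma(t_k))$ over all partitions $0=t_0<\dots<t_n=1$. **Theorem.** Let $X$ be a complete, simply-connected metric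 space with a convex local geodesic bicombing $\sigma$. Then $\bar d(x,y)<\infty$ for all $x,y\in X$, so that $\bar d$ is a metric on $X$, and there is exactly one convex geodesic bicombing $\tilde\sigma$ on $(X,\bar d)$ which is consistent with $\sigma$. Moreover, $X$ is contractible, and if $\sigma$ is reversible, then $\tilde\sigma$ is reversible as well. -/

import Mathlib

open Set Metric
open scoped ENNReal

noncomputable section

/-! ### Length of curves and the induced length metric -/

/-- The length of a continuous curve `γ : [0,1] → X`: the supremum of the sums
`∑ d(γ(t_{k-1}), γ(t_k))` over all finite partitions of `[0,1]`. -/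
def curveLength {X : Type*} [MetricSpace X] {x y : X} (γ : Path x y) : ℝ≥0∞ :=
  eVariationOn γ univ

/-- The infimum of the lengths of all continuous curves from `x` to `y`, with values in
`[0,∞]` (it is `∞` if there is no rectifiable curve from `x` to `y`). -/
def inducedLengthEDist {X : Type*} [MetricSpace X] (x y : X) : ℝ≥0∞ :=
  ⨅ γ : Path x y, curveLength γ

theorem edist_le_inducedLengthEDist {X : Type*} [MetricSpace X] (x y : X) :
    edist x y ≤ inducedLengthEDist x y := by
  refine le_iInf fun γ => ?_
  have h := eVariationOn.edist_le (γ : unitInterval → X) (s := univ) (mem_univ 0) (mem_univ 1)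
  rw [γ.source, γ.target] at h
  exact h

theorem inducedLengthEDist_self {X : Type*} [MetricSpace X] (x : X) :
    inducedLengthEDist x x = 0 := by
  refine le_antisymm ((iInf_le _ (Path.refl x)).trans ?_) bot_le
  refine (eVariationOn.constant_on ?_).le
  rintro _ ⟨s, -, rfl⟩ _ ⟨t, -, rfl⟩
  rfl

theorem inducedLengthEDist_comm_le {X : Type*} [MetricSpace X] (x y : X) :
    inducedLengthEDist x y ≤ inducedLengthEDist y x := by
  refine le_iInf fun γ => (iInf_le _ γ.symm).trans ?_
  refine eVariationOn.comp_le_of_antitoneOn (γ : unitInterval → X) unitInterval.symm (t := univ) ?_ (mapsTo_univ _ _)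
  intro s _ t _ hst
  exact unitInterval.symm_le_symm.2 hst

theorem curveLength_trans_le {X : Type*} [MetricSpace X] {x y z : X} (γ : Path x y)
    (δ : Path y z) : curveLength (γ.trans δ) ≤ curveLength γ + curveLength δ := by
  let h : unitInterval := ⟨1 / 2, by norm_num, by norm_num⟩
  have hu : (univ : Set unitInterval) = Iic h ∪ Ici h := by simp
  have hun : curveLength (γ.trans δ) =
      eVariationOn (γ.trans δ : unitInterval → X) (Iic h ∪ Ici h) := by
    rw [← hu]
    rfl
  rw [hun, eVariationOn.union (γ.trans δ : unitInterval → X) (x := h) ⟨self_mem_Iic, fun _ hb => hb⟩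
    ⟨self_mem_Ici, fun _ hb => hb⟩]
  let φ : unitInterval → unitInterval := fun t => projIcc 0 1 zero_le_one (2 * (t : ℝ))
  let ψ : unitInterval → unitInterval := fun t => projIcc 0 1 zero_le_one (2 * (t : ℝ) - 1)
  have hφ : Monotone φ := fun s t hst => monotone_projIcc _ (by
    have : (s : ℝ) ≤ t := hst
    linarith)
  have hψ : Monotone ψ := fun s t hst => monotone_projIcc _ (by
    have : (s : ℝ) ≤ t := hst
    linarith)
  have h1 : EqOn (γ.trans δ) (γ ∘ φ) (Iic h) := by
    intro t ht
    have ht' : (t : ℝ) ≤ 1 / 2 := ht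
    simp only [Path.trans_apply, ht', Function.comp, dif_pos]
    congr 1
    exact (projIcc_of_mem zero_le_one _).symm
  have h2 : EqOn (γ.trans δ) (δ ∘ ψ) (Ici h) := by
    intro t ht
    have ht' : 1 / 2 ≤ (t : ℝ) := ht
    rcases eq_or_lt_of_le ht' with h0 | h0
    · have h3 : ψ t = 0 := by
        simp only [ψ, ← h0]
        norm_num
      simp [Path.trans_apply, ← h0, h3]
    · have h3 : ¬ (t : ℝ) ≤ 1 / 2 := not_le.2 h0
      simp only [Path.trans_apply, h3, Function.comp, dif_neg, not_false_eq_true]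
      congr 1
      exact (projIcc_of_mem zero_le_one _).symm
  rw [eVariationOn.congr h1, eVariationOn.congr h2]
  exact add_le_add
    (eVariationOn.comp_le_of_monotoneOn _ φ (hφ.monotoneOn _) (mapsTo_univ _ _))
    (eVariationOn.comp_le_of_monotoneOn _ ψ (hψ.monotoneOn _) (mapsTo_univ _ _))

theorem inducedLengthEDist_triangle {X : Type*} [MetricSpace X] (x y z : X) :
    inducedLengthEDist x z ≤ inducedLengthEDist x y + inducedLengthEDist y z := by
  unfold inducedLengthEDist
  exact ENNReal.le_iInf_add_iInf fun γ δ =>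
    (iInf_le _ (γ.trans δ)).trans (curveLength_trans_le γ δ)

/-- The induced length metric as a metric with values in `[0,∞]`. -/
@[reducible]
def inducedLengthEMetric (X : Type*) [MetricSpace X] : EMetricSpace X where
  edist := inducedLengthEDist
  edist_self := inducedLengthEDist_self
  edist_comm x y := le_antisymm (inducedLengthEDist_comm_le x y) (inducedLengthEDist_comm_le y x)
  edist_triangle := inducedLengthEDist_triangle
  eq_of_edist_eq_zero {x y} hxy :=
    edist_le_zero.1 ((edist_le_inducedLengthEDist x y).trans (le_of_eq hxy))

/-- The induced length metric on `X`, once any two points of `X` are joined by a rectifiable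
curve. -/
@[reducible]
def inducedLengthMetric (X : Type*) [MetricSpace X]
    (h : ∀ x y : X, inducedLengthEDist x y ≠ ⊤) : MetricSpace X :=
  @EMetricSpace.toMetricSpace X (inducedLengthEMetric X) h

theorem inducedLengthMetric_dist {X : Type*} [MetricSpace X]
    (h : ∀ x y : X, inducedLengthEDist x y ≠ ⊤) (x y : X) :
    @dist X (inducedLengthMetric X h).toDist x y = (inducedLengthEDist x y).toReal :=
  rfl

/-! ### Geodesics and geodesic bicombings -/

/-- A geodesic, parametrized on `[0,1]` with constant speed. -/
def IsGeodesic {X : Type*} [MetricSpace X] (c : unitInterval → X) : Prop :=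
  Continuous c ∧ ∀ s t : unitInterval, dist (c s) (c t) = |(s : ℝ) - t| * dist (c 0) (c 1)

/-- The function `t ↦ d(c(t), c'(t))` is convex on `[0,1]`. -/
def HasConvexDist {X : Type*} [MetricSpace X] (c c' : unitInterval → X) : Prop :=
  ConvexOn ℝ (Icc (0 : ℝ) 1) (IccExtend zero_le_one fun t : unitInterval => dist (c t) (c' t))

/-- `τ` is a geodesic bicombing on the metric space `X`: a selection of a geodesic `τ x y` from
`x` to `y` for all `x, y`, which is consistent with taking subsegments. -/
structure IsGeodesicBicombing {X : Type*} [MetricSpace X] (τ : X → X → unitInterval → X) : Prop where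
  isGeodesic : ∀ x y, IsGeodesic (τ x y)
  source : ∀ x y, τ x y 0 = x
  target : ∀ x y, τ x y 1 = y
  consistent : ∀ x y p q, p ∈ range (τ x y) → q ∈ range (τ x y) → dist x p ≤ dist x q →
    range (τ p q) ⊆ range (τ x y)

/-- A convex geodesic bicombing. -/
structure IsConvexGeodesicBicombing {X : Type*} [MetricSpace X] (τ : X → X → unitInterval → X) : Prop
    extends IsGeodesicBicombing τ where
  convex : ∀ x y x' y', HasConvexDist (τ x y) (τ x' y')

/-- A geodesic bicombing is reversible if the segments from `x` to `y` and from `y` to `x`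
have the same image. -/
def IsReversibleBicombing {X : Type*} (τ : X → X → unitInterval → X) : Prop :=
  ∀ x y, range (τ y x) = range (τ x y)

/-! ### Local geodesic bicombings -/

/-- The pairs of points that lie in a common open ball `U(x, r x)`. -/
def localDomain {X : Type*} [MetricSpace X] (r : X → ℝ) : Set (X × X) :=
  {p | ∃ x, p.1 ∈ ball x (r x) ∧ p.2 ∈ ball x (r x)}

/-- A local geodesic bicombing on `X`: for every `x` a radius `r x > 0`, and a selection
`(y, z) ↦ seg y z` of geodesics from `y` to `z` for the pairs `(y, z)` that lie in a common ball
`U(x, r x)`, such that the geodesic stays in that ball, and subsegments of selected geodesics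
are selected. The values of `seg` at other pairs are irrelevant. -/
structure LocalGeodesicBicombing (X : Type*) [MetricSpace X] where
  r : X → ℝ
  r_pos : ∀ x, 0 < r x
  seg : X → X → unitInterval → X
  isGeodesic : ∀ y z, (y, z) ∈ localDomain r → IsGeodesic (seg y z)
  source : ∀ y z, (y, z) ∈ localDomain r → seg y z 0 = y
  target : ∀ y z, (y, z) ∈ localDomain r → seg y z 1 = z
  mem_ball : ∀ x, ∀ y ∈ ball x (r x), ∀ z ∈ ball x (r x), ∀ t, seg y z t ∈ ball x (r x)
  /-- Here `Icc.convexComb a b t` is the number `(1 - t) * a + t * b`. -/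
  consistent : ∀ y z, (y, z) ∈ localDomain r → ∀ a b : unitInterval, a ≤ b → ∀ t : unitInterval,
    seg (seg y z a) (seg y z b) t = seg y z (Icc.convexComb a b t)

namespace LocalGeodesicBicombing

/-- Convexity of a local geodesic bicombing, on each of the balls `U(x, r x)`. -/
def IsConvex {X : Type*} [MetricSpace X] (σ : LocalGeodesicBicombing X) : Prop :=
  ∀ x, ∀ y ∈ ball x (σ.r x), ∀ z ∈ ball x (σ.r x), ∀ y' ∈ ball x (σ.r x),
    ∀ z' ∈ ball x (σ.r x), HasConvexDist (σ.seg y z) (σ.seg y' z')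

/-- Reversibility of a local geodesic bicombing. -/
def IsReversible {X : Type*} [MetricSpace X] (σ : LocalGeodesicBicombing X) : Prop :=
  ∀ y z, (y, z) ∈ localDomain σ.r → ∀ t : unitInterval, σ.seg z y t = σ.seg y z (unitInterval.symm t)

/-- The curve `c` is consistent with the local geodesic bicombing `σ`. -/
def IsConsistent {X : Type*} [MetricSpace X] (σ : LocalGeodesicBicombing X) (c : unitInterval → X) : Prop :=
  ∀ a b : unitInterval, a ≤ b → (c a, c b) ∈ localDomain σ.r → ∀ t : unitInterval,
    c (Icc.convexComb a b t) = σ.seg (c a) (c b) t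

end LocalGeodesicBicombing

end

/-! This is a Cartan–Hadamard argument. Call a continuous curve locally consistent if its short
pieces are segments of `σ`. As long as two such curves stay pointwise in common balls, their
distance is a locally convex function of time, hence lies below its chord
(`IsLocallyConsistent.dist_le`). Completeness and an averaging iteration on chains of midpoints show
that such a curve follows every small displacement of its endpoints
(`IsLocallyConsistent.exists_deformation`).

Fix `x` and give the space of locally consistent curves from `x` the uniform metric. It is complete
and path connected, and by the two facts above the endpoint map to `X` is a local isometry. Segments
issuing from a point are Lipschitz, so they lift; this yields sections over the whole balls of `σ`,
hence lifts of all paths. Monodromy and simple connectedness then make the endpoint map bijective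
(`IsConvex.bijective_endpoint`): exactly one locally consistent curve, `IsConvex.curve`, joins two
given points. Uniqueness of the bicombing, its compatibility with subsegments and its reversibility
all follow from this.

For the metric, the curve from `x` to `y` has a constant local speed. When `y` moves slightly, the
speed changes by at most the displacement, so no path from `x` to `y` is shorter than this speed,
which is therefore the induced length distance. Convexity follows by letting the endpoints of a
curve slide along two other curves (`IsConvex.speed_curve_curve_le`). Retracting every point along
its curve to a base point contracts `X`. -/

open Filter Topology

/-! ### Local-to-global principles on the unit interval -/

/-- A form of Cousin's lemma: a transitive relation that holds between each point of `[0,1]` and all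
nearby points holds between any two points. -/
theorem unitInterval.induction_local {P : unitInterval → unitInterval → Prop}
    (trans : ∀ a b c, a ≤ b → b ≤ c → P a b → P b c → P a c)
    (loc : ∀ t, ∀ᶠ s in 𝓝 t, (s ≤ t → P s t) ∧ (t ≤ s → P t s))
    {a b : unitInterval} (hab : a ≤ b) : P a b := by
  have refl : ∀ t, P t t := fun t => (loc t).self_of_nhds.1 le_rfl
  let S : Set unitInterval := {t | a ≤ t ∧ t ≤ b ∧ P a t}
  have haS : a ∈ S := ⟨le_rfl, hab, refl a⟩
  have hlub := isLUB_sSup S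
  set m := sSup S
  have ham : a ≤ m := hlub.1 haS
  have hmb : m ≤ b := hlub.2 fun t ht => ht.2.1
  have hm : P a m := by
    have h1 := hlub.frequently_mem ⟨a, haS⟩
    have h2 : ∀ᶠ s in 𝓝[≤] m, s ≤ m → P s m :=
      ((loc m).filter_mono nhdsWithin_le_nhds).mono fun s hs => hs.1
    obtain ⟨s, hs, hs'⟩ := (h1.and_eventually h2).exists
    exact trans a s m hs.1 (hlub.1 hs) hs.2.2 (hs' (hlub.1 hs))
  rcases hmb.eq_or_lt with h | h
  · exact h ▸ hm
  · exfalso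
    have : (𝓝[>] m).NeBot := nhdsGT_neBot_of_exists_gt ⟨b, h⟩
    have h1 : ∀ᶠ s in 𝓝[>] m, m ≤ s → P m s :=
      ((loc m).filter_mono nhdsWithin_le_nhds).mono fun s hs => hs.2
    have h2 : ∀ᶠ s in 𝓝[>] m, s < b :=
      (eventually_lt_nhds h).filter_mono nhdsWithin_le_nhds
    obtain ⟨s, ⟨hs1, hs2⟩, hs3⟩ := ((h1.and h2).and self_mem_nhdsWithin).exists
    have hms : m < s := hs3
    exact absurd (hlub.1 (show s ∈ S from ⟨ham.trans hms.le, hs2.le,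
      trans a m s ham hms.le hm (hs1 hms.le)⟩)) (not_le.2 hms)

/-- A continuous locally convex function on `[0,1]` lies below its chord. -/
theorem unitInterval.le_chord_of_locally_convex {f : unitInterval → ℝ} (hf : Continuous f)
    (loc : ∀ t, ∀ᶠ p : unitInterval × unitInterval in 𝓝 (t, t), p.1 ≤ p.2 → ∀ s : unitInterval,
      f (Icc.convexComb p.1 p.2 s) ≤ (1 - s) * f p.1 + s * f p.2) (t : unitInterval) :
    f t ≤ (1 - t) * f 0 + t * f 1 := by
  let g : unitInterval → ℝ := fun t => f t - ((1 - t) * f 0 + t * f 1)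
  have hg : Continuous g := by fun_prop
  obtain ⟨m, -, hm⟩ := isCompact_univ.exists_isMaxOn (univ_nonempty) hg.continuousOn
  have hm' : ∀ t, g t ≤ g m := fun t => hm (mem_univ t)
  suffices h : g m ≤ 0 by
    have := (hm' t).trans h
    simp only [g] at this
    linarith
  by_contra! hpos
  have hK : IsCompact {t | g t = g m} := (isClosed_eq hg continuous_const).isCompact
  -- Take the leftmost maximum point of `g`. The points at distance `h₀` on its left and right then
  -- satisfy `g u < g s` and `g v ≤ g s`, against the midpoint inequality `2 * g s ≤ g u + g v`.
  obtain ⟨s, hs, hleast⟩ := hK.exists_isLeast ⟨m, rfl⟩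
  have hs : g s = g m := hs
  have hs0 : (0 : ℝ) < s := by
    rcases (show (0 : unitInterval) ≤ s from bot_le).eq_or_lt with h | h
    · rw [← hs, ← h] at hpos
      simp [g] at hpos
    · exact h
  have hs1 : (s : ℝ) < 1 := by
    rcases (show s ≤ (1 : unitInterval) from le_top).eq_or_lt with h | h
    · rw [← hs, h] at hpos
      simp [g] at hpos
    · exact h
  obtain ⟨ε, hε, h⟩ := Metric.eventually_nhds_iff.1 (loc s)
  obtain ⟨h₀, hh0, hhs, hh1, hhε⟩ : ∃ h₀ : ℝ, 0 < h₀ ∧ h₀ ≤ s ∧ h₀ ≤ 1 - s ∧ h₀ < ε := by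
    refine ⟨min (ε / 2) (min s (1 - s)), ?_, ?_, ?_, ?_⟩
    · exact lt_min (by positivity) (lt_min hs0 (by linarith))
    · exact (min_le_right _ _).trans (min_le_left _ _)
    · exact (min_le_right _ _).trans (min_le_right _ _)
    · exact (min_le_left _ _).trans_lt (by linarith)
  let u : unitInterval := ⟨s - h₀, by linarith, by linarith⟩
  let v : unitInterval := ⟨s + h₀, by linarith, by linarith⟩
  have huv : dist (u, v) (s, s) < ε := by
    rw [Prod.dist_eq]
    refine max_lt ?_ ?_
    · change |(s : ℝ) - h₀ - s| < ε
      rwa [sub_sub_cancel_left, abs_neg, abs_of_pos hh0]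
    · change |(s : ℝ) + h₀ - s| < ε
      rwa [add_sub_cancel_left, abs_of_pos hh0]
  have key := h huv (show u ≤ v from by
    change (s : ℝ) - h₀ ≤ s + h₀
    linarith) ⟨1 / 2, by norm_num, by norm_num⟩
  have hmid : Icc.convexComb u v ⟨1 / 2, by norm_num, by norm_num⟩ = s := by
    apply Subtype.ext
    simp [u, v]
    ring
  rw [hmid] at key
  have hu : g u < g m := by
    refine (hm' u).lt_of_ne fun he => ?_
    have : (s : ℝ) ≤ s - h₀ := hleast (show u ∈ {t | g t = g m} from he)
    linarith
  have hv := hm' v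
  rw [← hs] at hu hv
  simp only [g, u, v] at hu hv key
  linarith

theorem Icc.convexComb_convexComb (a b u v s : unitInterval) :
    Icc.convexComb (Icc.convexComb a b u) (Icc.convexComb a b v) s =
      Icc.convexComb a b (Icc.convexComb u v s) := by
  apply Subtype.ext
  simp
  ring

theorem Icc.convexComb_mono {a b : unitInterval} (hab : a ≤ b) : Monotone (Icc.convexComb a b) := by
  intro u v huv
  have h1 : (a : ℝ) ≤ b := hab
  have h2 : (u : ℝ) ≤ v := huv
  change ((Icc.convexComb a b u : unitInterval) : ℝ) ≤ (Icc.convexComb a b v : unitInterval)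
  simp
  nlinarith

theorem Icc.convexComb_mem_ball {t u v : unitInterval} {δ : ℝ} (hu : u ∈ ball t δ)
    (hv : v ∈ ball t δ) (s : unitInterval) : Icc.convexComb u v s ∈ ball t δ := by
  change ((Icc.convexComb u v s : unitInterval) : ℝ) ∈ ball (t : ℝ) δ
  rw [Icc.coe_convexComb]
  exact convex_ball (t : ℝ) δ hu hv (sub_nonneg.2 s.2.2) s.2.1 (by ring)

/-! ### Locally consistent curves -/

namespace LocalGeodesicBicombing

variable {X : Type*} [MetricSpace X] {σ : LocalGeodesicBicombing X}

/-- A continuous curve all of whose short pieces are geodesics of `σ`. -/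
def IsLocallyConsistent (σ : LocalGeodesicBicombing X) (c : unitInterval → X) : Prop :=
  Continuous c ∧ ∀ t, ∀ᶠ p : unitInterval × unitInterval in 𝓝 (t, t), p.1 ≤ p.2 →
    ∀ s : unitInterval, c (Icc.convexComb p.1 p.2 s) = σ.seg (c p.1) (c p.2) s

theorem mem_localDomain {x y z : X} (hy : y ∈ ball x (σ.r x)) (hz : z ∈ ball x (σ.r x)) :
    (y, z) ∈ localDomain σ.r :=
  ⟨x, hy, hz⟩

theorem mem_ball_self (σ : LocalGeodesicBicombing X) (x : X) : x ∈ ball x (σ.r x) :=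
  Metric.mem_ball_self (σ.r_pos x)

theorem mem_localDomain_self (σ : LocalGeodesicBicombing X) (x : X) :
    (x, x) ∈ localDomain σ.r :=
  mem_localDomain (σ.mem_ball_self x) (σ.mem_ball_self x)

theorem seg_self (σ : LocalGeodesicBicombing X) (x : X) (t : unitInterval) : σ.seg x x t = x := by
  have hx := σ.mem_localDomain_self x
  have h := (σ.isGeodesic x x hx).2 t 0
  rw [σ.source x x hx, σ.target x x hx, dist_self, mul_zero] at h
  exact dist_eq_zero.1 h

theorem isLocallyConsistent_seg {y z : X} (h : (y, z) ∈ localDomain σ.r) :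
    σ.IsLocallyConsistent (σ.seg y z) :=
  ⟨(σ.isGeodesic y z h).1, fun _ => .of_forall fun p hp s => (σ.consistent y z h p.1 p.2 hp s).symm⟩

theorem isLocallyConsistent_const (σ : LocalGeodesicBicombing X) (x : X) :
    σ.IsLocallyConsistent fun _ => x :=
  ⟨continuous_const, fun _ => .of_forall fun _ _ s => (σ.seg_self x s).symm⟩

theorem IsLocallyConsistent.comp_convexComb {c : unitInterval → X} (hc : σ.IsLocallyConsistent c)
    {a b : unitInterval} (hab : a ≤ b) : σ.IsLocallyConsistent fun t => c (Icc.convexComb a b t) := by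
  refine ⟨hc.1.comp (by fun_prop), fun t => ?_⟩
  have h : Tendsto (fun p : unitInterval × unitInterval =>
      (Icc.convexComb a b p.1, Icc.convexComb a b p.2)) (𝓝 (t, t))
      (𝓝 (Icc.convexComb a b t, Icc.convexComb a b t)) := by
    refine Continuous.tendsto' ?_ _ _ rfl
    fun_prop
  refine (h.eventually (hc.2 _)).mono fun p hp hle s => ?_
  simp only [← Icc.convexComb_convexComb]
  exact hp (Icc.convexComb_mono hab hle) s

theorem IsLocallyConsistent.symm (hr : σ.IsReversible) {c : unitInterval → X}
    (hc : σ.IsLocallyConsistent c) : σ.IsLocallyConsistent fun t => c (unitInterval.symm t) := by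
  refine ⟨hc.1.comp unitInterval.continuous_symm, fun t => ?_⟩
  have h : Tendsto (fun p : unitInterval × unitInterval =>
      (unitInterval.symm p.2, unitInterval.symm p.1)) (𝓝 (t, t))
      (𝓝 (unitInterval.symm t, unitInterval.symm t)) :=
    Continuous.tendsto' (by fun_prop) _ _ rfl
  set x := c (unitInterval.symm t) with hx
  have hb : ∀ᶠ u in 𝓝 t, c (unitInterval.symm u) ∈ ball x (σ.r x) :=
    (hc.1.comp unitInterval.continuous_symm).continuousAt.eventually
      (isOpen_ball.mem_nhds (σ.mem_ball_self x))
  have hb2 := hb.prod_nhds hb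
  filter_upwards [h.eventually (hc.2 _), hb2] with p hp hpb hle s
  have := hp (unitInterval.symm_le_symm.2 hle) (unitInterval.symm s)
  rw [hr _ _ (mem_localDomain hpb.2 hpb.1), ← this]
  congr 1
  apply Subtype.ext
  simp
  ring

theorem IsConvex.dist_seg_le (hσ : σ.IsConvex) {x y z y' z' : X} (hy : y ∈ ball x (σ.r x))
    (hz : z ∈ ball x (σ.r x)) (hy' : y' ∈ ball x (σ.r x)) (hz' : z' ∈ ball x (σ.r x))
    (t : unitInterval) :
    dist (σ.seg y z t) (σ.seg y' z' t) ≤ (1 - t) * dist y y' + t * dist z z' := by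
  obtain ⟨-, h⟩ := hσ x y hy z hz y' hy' z' hz'
  replace h := h (left_mem_Icc.2 zero_le_one)
    (right_mem_Icc.2 zero_le_one) (a := 1 - t) (b := t) (sub_nonneg.2 t.2.2) t.2.1 (by ring)
  have e : (1 - (t : ℝ)) • (0 : ℝ) + (t : ℝ) • 1 = t := by simp
  rw [e, IccExtend_val, IccExtend_left, IccExtend_right] at h
  change _ ≤ (1 - (t : ℝ)) * dist (σ.seg y z 0) (σ.seg y' z' 0)
    + t * dist (σ.seg y z 1) (σ.seg y' z' 1) at h
  have d := mem_localDomain hy hz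
  have d' := mem_localDomain hy' hz'
  rwa [σ.source y z d, σ.target y z d, σ.source _ _ d', σ.target _ _ d'] at h

/-- Two locally consistent curves that stay pointwise in common balls are at a distance that is
bounded by the linear interpolation of the distances of their endpoints. -/
theorem IsLocallyConsistent.dist_le (hσ : σ.IsConvex) {c c' : unitInterval → X}
    (hc : σ.IsLocallyConsistent c) (hc' : σ.IsLocallyConsistent c')
    (h : ∀ t, ∃ x, c t ∈ ball x (σ.r x) ∧ c' t ∈ ball x (σ.r x)) (t : unitInterval) :
    dist (c t) (c' t) ≤ (1 - t) * dist (c 0) (c' 0) + t * dist (c 1) (c' 1) := by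
  refine unitInterval.le_chord_of_locally_convex (f := fun t => dist (c t) (c' t))
    (hc.1.dist hc'.1) (fun t => ?_) t
  obtain ⟨x, hx, hx'⟩ := h t
  have hb : ∀ᶠ u in 𝓝 t, c u ∈ ball x (σ.r x) ∧ c' u ∈ ball x (σ.r x) :=
    (hc.1.continuousAt.eventually (isOpen_ball.mem_nhds hx)).and
      (hc'.1.continuousAt.eventually (isOpen_ball.mem_nhds hx'))
  filter_upwards [hc.2 t, hc'.2 t, hb.prod_nhds hb] with p hp hp' hpb hle s
  rw [hp hle, hp' hle]
  exact hσ.dist_seg_le hpb.1.1 hpb.2.1 hpb.1.2 hpb.2.2 s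

/-- A locally consistent curve inside one of the balls `U(x, r x)` is a geodesic of `σ`. -/
theorem IsLocallyConsistent.eq_seg (hσ : σ.IsConvex) {c : unitInterval → X}
    (hc : σ.IsLocallyConsistent c) {x : X} (h : ∀ t, c t ∈ ball x (σ.r x)) (t : unitInterval) :
    c t = σ.seg (c 0) (c 1) t := by
  have d := mem_localDomain (h 0) (h 1)
  have := hc.dist_le hσ (isLocallyConsistent_seg d)
    (fun t => ⟨x, h t, σ.mem_ball x _ (h 0) _ (h 1) t⟩) t
  rw [σ.source _ _ d, σ.target _ _ d] at this
  simpa using this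

theorem IsConvex.tendsto_seg (hσ : σ.IsConvex) {ι : Type*} {l : Filter ι} {f g : ι → X} {y z x : X}
    (hf : Tendsto f l (𝓝 y)) (hg : Tendsto g l (𝓝 z)) (hy : y ∈ ball x (σ.r x))
    (hz : z ∈ ball x (σ.r x)) (t : unitInterval) :
    Tendsto (fun i => σ.seg (f i) (g i) t) l (𝓝 (σ.seg y z t)) := by
  rw [tendsto_iff_dist_tendsto_zero]
  refine squeeze_zero' (.of_forall fun _ => dist_nonneg)
    (g := fun i => (1 - (t : ℝ)) * dist (f i) y + t * dist (g i) z) ?_ ?_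
  · filter_upwards [hf.eventually (isOpen_ball.mem_nhds hy), hg.eventually (isOpen_ball.mem_nhds hz)]
      with i h1 h2
    exact hσ.dist_seg_le h1 h2 hy hz t
  · have h1 := (tendsto_iff_dist_tendsto_zero.1 hf).const_mul (1 - (t : ℝ))
    have h2 := (tendsto_iff_dist_tendsto_zero.1 hg).const_mul (t : ℝ)
    simpa using h1.add h2

/-- Uniform limits of locally consistent curves are locally consistent. -/
theorem IsConvex.isClosed_isLocallyConsistent (hσ : σ.IsConvex) :
    IsClosed {c : C(unitInterval, X) | σ.IsLocallyConsistent c} := by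
  refine IsSeqClosed.isClosed fun f c hf hfc => ⟨c.continuous, fun t => ?_⟩
  set x := c t
  have hr := σ.r_pos x
  have hball : ∀ᶠ u in 𝓝 t, c u ∈ ball x (σ.r x / 2) :=
    c.continuous.continuousAt.eventually (isOpen_ball.mem_nhds (Metric.mem_ball_self (by positivity)))
  obtain ⟨δ, hδ, hball⟩ := Metric.eventually_nhds_iff_ball.1 hball
  have hb := Metric.ball_mem_nhds t hδ
  filter_upwards [prod_mem_nhds hb hb] with p hp hle s
  have hev : ∀ᶠ n in atTop, dist (f n) c < σ.r x / 2 :=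
    (tendsto_iff_dist_tendsto_zero.1 hfc).eventually (gt_mem_nhds (by positivity))
  -- The intervals on which local consistency of `f n` is given could shrink with `n`. Since `f n`
  -- maps the whole `δ`-ball into one ball of `σ`, `eq_seg` makes it a segment there, uniformly in
  -- `n`.
  have hev' : ∀ᶠ n in atTop, f n (Icc.convexComb p.1 p.2 s) = σ.seg (f n p.1) (f n p.2) s := by
    filter_upwards [hev] with n hn
    have hin : ∀ u ∈ ball t δ, f n u ∈ ball x (σ.r x) := fun u hu => by
      have h1 := (ContinuousMap.dist_apply_le_dist (f := f n) (g := c) u).trans_lt hn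
      have h2 := Metric.mem_ball.1 (hball u hu)
      have := dist_triangle (f n u) (c u) x
      rw [Metric.mem_ball]
      linarith
    have := ((hf n).comp_convexComb hle).eq_seg hσ (x := x)
      (fun u => hin _ (Icc.convexComb_mem_ball hp.1 hp.2 u)) s
    simpa using this
  have ev : ∀ u, Tendsto (fun n => f n u) atTop (𝓝 (c u)) := fun u =>
    ((continuous_eval_const u).tendsto c).comp hfc
  have hsub : ∀ u ∈ ball t δ, c u ∈ ball x (σ.r x) := fun u hu =>
    ball_subset_ball (by linarith) (hball u hu)
  exact tendsto_nhds_unique (ev _) ((hσ.tendsto_seg (ev p.1) (ev p.2) (hsub _ hp.1)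
    (hsub _ hp.2) s).congr' (hev'.mono fun n hn => hn.symm))

end LocalGeodesicBicombing

/-! ### Deformation of locally consistent curves -/

/-- The point `1 / 2` of the unit interval. -/
noncomputable def unitInterval.half : unitInterval := ⟨1 / 2, by norm_num, by norm_num⟩

@[simp]
theorem unitInterval.coe_half : (unitInterval.half : ℝ) = 1 / 2 := rfl

/-- The point `i / N` of the unit interval. -/
noncomputable def unitInterval.node (N i : ℕ) : unitInterval := projIcc 0 1 zero_le_one (i / N : ℝ)

theorem unitInterval.coe_node {N i : ℕ} (h : i ≤ N) : (unitInterval.node N i : ℝ) = i / N := by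
  unfold unitInterval.node
  rw [projIcc_of_mem zero_le_one (x := (i / N : ℝ))
    ⟨by positivity, div_le_one_of_le₀ (by exact_mod_cast h) (by positivity)⟩]

theorem unitInterval.node_zero (N : ℕ) : unitInterval.node N 0 = 0 := by
  apply Subtype.ext
  rw [unitInterval.coe_node (Nat.zero_le N)]
  simp

theorem unitInterval.node_self {N : ℕ} (hN : N ≠ 0) : unitInterval.node N N = 1 := by
  apply Subtype.ext
  have : (N : ℝ) ≠ 0 := by exact_mod_cast hN
  rw [unitInterval.coe_node le_rfl, div_self this]
  rfl

open unitInterval (half node)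

namespace LocalGeodesicBicombing

variable {X : Type*} [MetricSpace X] {σ : LocalGeodesicBicombing X}

/-- A chain of points in which each point is the midpoint of its two neighbours can be moved along
with small displacements of its endpoints. -/
theorem IsConvex.exists_midpoint_chain [CompleteSpace X] (hσ : σ.IsConvex) {N : ℕ} (hN : N ≠ 0)
    {ε : ℝ} (hε : 0 ≤ ε) {q : ℕ → X}
    (hball : ∀ i, i + 2 ≤ N → ∃ x, closedBall (q i) ε ⊆ ball x (σ.r x) ∧
      closedBall (q (i + 2)) ε ⊆ ball x (σ.r x))
    (hq : ∀ i, i + 2 ≤ N → q (i + 1) = σ.seg (q i) (q (i + 2)) half)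
    {y z : X} (hy : dist y (q 0) ≤ ε) (hz : dist z (q N) ≤ ε) :
    ∃ p : ℕ → X, p 0 = y ∧ p N = z ∧ (∀ i ≤ N, dist (p i) (q i) ≤ ε) ∧
      ∀ i, i + 2 ≤ N → p (i + 1) = σ.seg (p i) (p (i + 2)) half := by
  -- One relaxation step: every interior point is replaced, simultaneously, by the midpoint of its
  -- neighbours, with the ends held fixed. The iteration starts from `q` with its ends moved to `y`
  -- and `z`; the desired chain is its limit, a fixed point of `Φ`.
  let Φ : (ℕ → X) → ℕ → X := fun p i =>
    if 0 < i ∧ i < N then σ.seg (p (i - 1)) (p (i + 1)) half else p i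
  let p₀ : ℕ → X := fun i => if i = 0 then y else if i < N then q i else z
  let P : ℕ → ℕ → X := fun k => Φ^[k] p₀
  have hP : ∀ k i, i + 2 ≤ N → P (k + 1) (i + 1) = σ.seg (P k i) (P k (i + 2)) half := by
    intro k i hi
    have h1 : P (k + 1) = Φ (P k) := Function.iterate_succ_apply' _ _ _
    rw [h1]
    have h2 : 0 < i + 1 ∧ i + 1 < N := ⟨by omega, by omega⟩
    simp only [Φ, h2, and_self, if_true, Nat.add_sub_cancel]
  have hP' : ∀ k i, ¬ (0 < i ∧ i < N) → P (k + 1) i = P k i := by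
    intro k i hi
    have h1 : P (k + 1) = Φ (P k) := Function.iterate_succ_apply' _ _ _
    rw [h1]
    simp only [Φ, hi, if_false]
  have hcases : ∀ i, ¬ (0 < i ∧ i < N) ∨ ∃ j, i = j + 1 ∧ j + 2 ≤ N := by
    intro i
    by_cases h : 0 < i ∧ i < N
    · exact Or.inr ⟨i - 1, by omega, by omega⟩
    · exact Or.inl h
  have hPy : ∀ k, P k 0 = y := by
    intro k
    induction k with
    | zero => simp [P, p₀]
    | succ k ih => rw [hP' k 0 (by omega), ih]
  have hPz : ∀ k, P k N = z := by
    intro k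
    induction k with
    | zero => simp [P, p₀, hN]
    | succ k ih => rw [hP' k N (by omega), ih]
  have hnear : ∀ k, ∀ i ≤ N, dist (P k i) (q i) ≤ ε := by
    intro k
    induction k with
    | zero =>
      intro i hi
      by_cases h0 : i = 0
      · subst h0
        rw [hPy]
        exact hy
      · by_cases h1 : i < N
        · simpa [P, p₀, h0, h1] using hε
        · obtain rfl : i = N := by omega
          rw [hPz]
          exact hz
    | succ k ih =>
      intro i hi
      rcases hcases i with h | ⟨j, rfl, hj⟩
      · rw [hP' k i h]
        exact ih i hi
      · rw [hP k j hj, hq j hj]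
        obtain ⟨x, hx1, hx2⟩ := hball j hj
        have h1 := ih j (by omega)
        have h2 := ih (j + 2) hj
        have := hσ.dist_seg_le (hx1 h1) (hx2 h2) (hx1 (mem_closedBall_self hε))
          (hx2 (mem_closedBall_self hε)) half
        simp only [unitInterval.coe_half] at this
        linarith
  have hN1 : (1 : ℝ) ≤ N := by exact_mod_cast Nat.one_le_iff_ne_zero.2 hN
  -- Successive displacements are compared with the concave weight `w i = i * (N - i)`. The average
  -- of `w` over the two neighbours of `i` is `w i - 1`, and `w ≤ N ^ 2` gives `w i - 1 ≤ κ * w i`,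
  -- so each step contracts by the factor `κ`.
  set κ : ℝ := 1 - 1 / (N : ℝ) ^ 2 with hκ
  have hκ0 : 0 ≤ κ := by
    rw [hκ, sub_nonneg, div_le_one (by positivity)]
    nlinarith
  have hκ1 : κ < 1 := by
    rw [hκ]
    have : 0 < 1 / (N : ℝ) ^ 2 := by positivity
    linarith
  have hstep : ∀ k, ∀ i ≤ N, dist (P k i) (P (k + 1) i) ≤ 2 * ε * κ ^ k * (i * (N - i)) := by
    intro k
    induction k with
    | zero =>
      intro i hi
      have hi' : (i : ℝ) ≤ N := by exact_mod_cast hi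
      rcases hcases i with h | ⟨j, rfl, hj⟩
      · rw [hP' 0 i h, dist_self]
        have : 0 ≤ (i : ℝ) * (N - i) := mul_nonneg (by positivity) (by linarith)
        positivity
      · have h1 := hnear 0 (j + 1) hi
        have h2 := hnear 1 (j + 1) hi
        have h3 := dist_triangle_right (P 0 (j + 1)) (P 1 (j + 1)) (q (j + 1))
        have hj' : (j : ℝ) + 2 ≤ N := by exact_mod_cast hj
        have hj0 : (0 : ℝ) ≤ j := by positivity
        have h4 : 1 ≤ ((j + 1 : ℕ) : ℝ) * (N - (j + 1 : ℕ)) := by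
          push_cast
          nlinarith
        simp only [pow_zero, mul_one, zero_add]
        nlinarith
    | succ k ih =>
      intro i hi
      have hi' : (i : ℝ) ≤ N := by exact_mod_cast hi
      rcases hcases i with h | ⟨j, rfl, hj⟩
      · rw [hP' (k + 1) i h, dist_self]
        have : 0 ≤ (i : ℝ) * (N - i) := mul_nonneg (by positivity) (by linarith)
        positivity
      · obtain ⟨x, hx1, hx2⟩ := hball j hj
        rw [hP k j hj, hP (k + 1) j hj]
        have h0 := hσ.dist_seg_le (hx1 (hnear k j (by omega))) (hx2 (hnear k (j + 2) hj))
          (hx1 (hnear (k + 1) j (by omega))) (hx2 (hnear (k + 1) (j + 2) hj)) half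
        refine h0.trans ?_
        have h1 := ih j (by omega)
        have h2 := ih (j + 2) hj
        have hw : ((j + 1 : ℕ) : ℝ) * (N - (j + 1 : ℕ)) - 1 ≤
            κ * (((j + 1 : ℕ) : ℝ) * (N - (j + 1 : ℕ))) := by
          have h3 : ((j + 1 : ℕ) : ℝ) * (N - (j + 1 : ℕ)) ≤ N ^ 2 := by
            have : (0 : ℝ) ≤ (j + 1 : ℕ) := by positivity
            nlinarith
          rw [hκ, sub_mul, one_mul]
          have : 1 / (N : ℝ) ^ 2 * (((j + 1 : ℕ) : ℝ) * (N - (j + 1 : ℕ))) ≤ 1 := by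
            rw [one_div, inv_mul_le_one₀ (by positivity)]
            exact h3
          linarith
        have hC : 0 ≤ 2 * ε * κ ^ k := by positivity
        calc _ ≤ (1 / 2) * (2 * ε * κ ^ k * (j * (N - j)))
              + (1 / 2) * (2 * ε * κ ^ k * ((j + 2 : ℕ) * (N - (j + 2 : ℕ)))) := by
              simp only [unitInterval.coe_half]
              linarith
          _ = 2 * ε * κ ^ k * (((j + 1 : ℕ) : ℝ) * (N - (j + 1 : ℕ)) - 1) := by
              push_cast
              ring
          _ ≤ 2 * ε * κ ^ k * (κ * (((j + 1 : ℕ) : ℝ) * (N - (j + 1 : ℕ)))) :=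
              mul_le_mul_of_nonneg_left hw hC
          _ = _ := by ring
  have hlim : ∀ i, ∃ l, i ≤ N → Tendsto (fun k => P k i) atTop (𝓝 l) := by
    intro i
    by_cases hi : i ≤ N
    · have hc : CauchySeq fun k => P k i :=
        cauchySeq_of_le_geometric κ (2 * ε * (i * (N - i))) hκ1 fun k => by
          refine (hstep k i hi).trans_eq ?_
          ring
      obtain ⟨l, hl⟩ := cauchySeq_tendsto_of_complete hc
      exact ⟨l, fun _ => hl⟩
    · exact ⟨y, fun h => absurd h hi⟩
  choose p hp using hlim
  have hpq : ∀ i ≤ N, dist (p i) (q i) ≤ ε := fun i hi =>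
    le_of_tendsto ((hp i hi).dist tendsto_const_nhds) (.of_forall fun k => hnear k i hi)
  refine ⟨p, ?_, ?_, hpq, fun i hi => ?_⟩
  · have := hp 0 (Nat.zero_le N)
    simp only [hPy] at this
    exact tendsto_nhds_unique this tendsto_const_nhds |>.symm ▸ rfl
  · have := hp N le_rfl
    simp only [hPz] at this
    exact tendsto_nhds_unique this tendsto_const_nhds |>.symm ▸ rfl
  · obtain ⟨x, hx1, hx2⟩ := hball i hi
    have h1 := (hp (i + 1) (by omega)).comp (tendsto_add_atTop_nat 1)
    refine tendsto_nhds_unique h1 ?_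
    refine (hσ.tendsto_seg (hp i (by omega)) (hp (i + 2) hi) (hx1 (hpq i (by omega)))
      (hx2 (hpq _ hi)) half).congr fun k => ?_
    exact (hP k i hi).symm

/-- A chain of points in which each point is the midpoint of its two neighbours spans a locally
consistent curve. -/
theorem exists_isLocallyConsistent_of_chain {N : ℕ} (hN : 2 ≤ N) {p : ℕ → X}
    (hdom : ∀ i, i + 2 ≤ N → (p i, p (i + 2)) ∈ localDomain σ.r)
    (hp : ∀ i, i + 2 ≤ N → p (i + 1) = σ.seg (p i) (p (i + 2)) half) :
    ∃ c, σ.IsLocallyConsistent c ∧ ∀ i, i + 2 ≤ N → ∀ s,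
      c (Icc.convexComb (node N i) (node N (i + 2)) s) = σ.seg (p i) (p (i + 2)) s := by
  have hN0 : (0 : ℝ) < N := by
    have : 0 < N := by omega
    exact_mod_cast this
  let φ : ℕ → unitInterval → unitInterval := fun i t =>
    projIcc 0 1 zero_le_one (((N : ℝ) * t - i) / 2)
  have hφc : ∀ i, Continuous (φ i) := fun i => continuous_projIcc.comp (by fun_prop)
  have hφ : ∀ (i : ℕ) (t : unitInterval), (i : ℝ) ≤ N * t → (N : ℝ) * t ≤ i + 2 →
      (φ i t : ℝ) = ((N : ℝ) * t - i) / 2 := by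
    intro i t h1 h2
    simp only [φ]
    rw [projIcc_of_mem zero_le_one (x := ((N : ℝ) * t - i) / 2) ⟨by linarith, by linarith⟩]
  -- The index of a block `[i / N, (i + 2) / N]` that contains `t`, capped so that the last block
  -- ends at `1`. On block `i` the curve is the segment from `p i` to `p (i + 2)`, with parameter `φ
  -- i`.
  let J : unitInterval → ℕ := fun t => min ⌊(N : ℝ) * t⌋₊ (N - 2)
  let c : unitInterval → X := fun t => σ.seg (p (J t)) (p (J t + 2)) (φ (J t) t)
  have hc : ∀ i, i + 2 ≤ N → ∀ t : unitInterval, (i : ℝ) ≤ N * t → (N : ℝ) * t ≤ i + 2 →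
      c t = σ.seg (p i) (p (i + 2)) (φ i t) := by
    intro i hi t h1 h2
    have ht0 : (0 : ℝ) ≤ N * t := mul_nonneg hN0.le t.2.1
    have hJ1 : i ≤ J t := le_min (Nat.le_floor h1) (by omega)
    have hJN : J t + 2 ≤ N := by
      have : J t ≤ N - 2 := min_le_right _ _
      omega
    have hJt : (J t : ℝ) ≤ N * t := by
      have h3 : J t ≤ ⌊(N : ℝ) * t⌋₊ := min_le_left _ _
      exact (Nat.cast_le.2 h3).trans (Nat.floor_le ht0)
    have hJ2 : J t ≤ i + 2 := by
      have := hJt.trans h2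
      exact_mod_cast this
    simp only [c]
    generalize J t = j at *
    obtain rfl | rfl | rfl : j = i ∨ j = i + 1 ∨ j = i + 2 := by omega
    · rfl
    -- On the overlap of consecutive blocks, the second half of one segment and the first half of
    -- the next are both the segment from `p (i + 1)` to `p (i + 2)`, by the midpoint property.
    · have hu : (N : ℝ) * t - i - 1 ∈ Icc (0 : ℝ) 1 := by
        push_cast at hJt
        exact ⟨by linarith, by linarith⟩
      let u : unitInterval := ⟨(N : ℝ) * t - i - 1, hu⟩
      have e1 : φ (i + 1) t = Icc.convexComb 0 half u := by
        apply Subtype.ext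
        rw [hφ _ _ hJt (by push_cast; linarith)]
        simp [u]
        ring
      have e2 : φ i t = Icc.convexComb half 1 u := by
        apply Subtype.ext
        rw [hφ _ _ h1 h2]
        simp [u]
        ring
      have d1 := hdom (i + 1) hJN
      have d2 := hdom i hi
      rw [e1, e2, ← σ.consistent _ _ d1 0 half bot_le u, ← σ.consistent _ _ d2 half 1 le_top u,
        σ.source _ _ d1, σ.target _ _ d2, ← hp (i + 1) hJN, ← hp i hi]
    · have e0 : (N : ℝ) * t = i + 2 := le_antisymm h2 (by exact_mod_cast hJt)
      have e1 : φ (i + 2) t = 0 := by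
        apply Subtype.ext
        rw [hφ _ _ hJt (by push_cast; linarith), e0]
        push_cast
        norm_num
      have e2 : φ i t = 1 := by
        apply Subtype.ext
        rw [hφ _ _ h1 h2, e0]
        norm_num
      rw [e1, e2, σ.source _ _ (hdom _ hJN), σ.target _ _ (hdom _ hi)]
  have hnhds : ∀ t : unitInterval, ∃ i, i + 2 ≤ N ∧
      ∀ᶠ u : unitInterval in 𝓝 t, (i : ℝ) ≤ N * u ∧ (N : ℝ) * u ≤ i + 2 := by
    intro t
    have hcont : Continuous fun u : unitInterval => (N : ℝ) * u := by fun_prop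
    rcases lt_or_ge ((N : ℝ) * t) 2 with h | h
    · refine ⟨0, by omega, (hcont.continuousAt.eventually (gt_mem_nhds h)).mono fun u hu => ?_⟩
      have : (0 : ℝ) ≤ N * u := mul_nonneg hN0.le u.2.1
      push_cast
      exact ⟨this, by linarith⟩
    rcases lt_or_ge ((N : ℝ) - 2) ((N : ℝ) * t) with h' | h'
    · refine ⟨N - 2, by omega, (hcont.continuousAt.eventually (lt_mem_nhds h')).mono fun u hu => ?_⟩
      have : (N : ℝ) * u ≤ N := mul_le_of_le_one_right hN0.le u.2.2
      push_cast [hN]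
      exact ⟨hu.le, by linarith⟩
    -- The ceiling minus one, unlike the floor, puts `N * t` strictly inside a block even when it is
    -- an integer.
    · have hceil : 2 ≤ ⌈(N : ℝ) * t⌉₊ := by
        have := h.trans (Nat.le_ceil _)
        exact_mod_cast this
      have h1 : ((⌈(N : ℝ) * t⌉₊ - 1 : ℕ) : ℝ) < N * t := by
        have := Nat.ceil_lt_add_one (show (0 : ℝ) ≤ N * t by linarith)
        rw [Nat.cast_sub (by omega)]
        push_cast
        linarith
      have h2 : (N : ℝ) * t < ((⌈(N : ℝ) * t⌉₊ - 1 : ℕ) : ℝ) + 2 := by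
        have := Nat.le_ceil ((N : ℝ) * t)
        rw [Nat.cast_sub (by omega)]
        push_cast
        linarith
      refine ⟨⌈(N : ℝ) * t⌉₊ - 1, ?_, ?_⟩
      · have : ⌈(N : ℝ) * t⌉₊ ≤ N - 2 := Nat.ceil_le.2 (by push_cast [hN]; exact h')
        omega
      · filter_upwards [hcont.continuousAt.eventually (lt_mem_nhds h1),
          hcont.continuousAt.eventually (gt_mem_nhds h2)] with u hu hu'
        exact ⟨hu.le, hu'.le⟩
  refine ⟨c, ⟨continuous_iff_continuousAt.2 fun t => ?_, fun t => ?_⟩, fun i hi s => ?_⟩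
  · obtain ⟨i, hi, hev⟩ := hnhds t
    have hs := ((σ.isGeodesic _ _ (hdom i hi)).1.comp (hφc i)).continuousAt (x := t)
    refine hs.congr (hev.mono fun u hu => ?_)
    exact (hc i hi u hu.1 hu.2).symm
  · obtain ⟨i, hi, hev⟩ := hnhds t
    filter_upwards [hev.prod_nhds hev] with u hu hle s
    obtain ⟨⟨h1, h2⟩, h3, h4⟩ := hu
    have hle' : (u.1 : ℝ) ≤ u.2 := hle
    have hs0 := s.2.1
    have hs1 := s.2.2
    have h5 : (i : ℝ) ≤ N * (Icc.convexComb u.1 u.2 s : unitInterval) := by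
      rw [Icc.coe_convexComb]
      nlinarith
    have h6 : (N : ℝ) * (Icc.convexComb u.1 u.2 s : unitInterval) ≤ i + 2 := by
      rw [Icc.coe_convexComb]
      nlinarith
    rw [hc i hi _ h1 h2, hc i hi _ h3 h4, hc i hi _ h5 h6, σ.consistent _ _ (hdom i hi)]
    · congr 1
      apply Subtype.ext
      rw [Icc.coe_convexComb, hφ _ _ h1 h2, hφ _ _ h3 h4, hφ _ _ h5 h6, Icc.coe_convexComb]
      ring
    · refine monotone_projIcc _ ?_
      have := mul_le_mul_of_nonneg_left hle' hN0.le
      linarith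
  · have e : (Icc.convexComb (node N i) (node N (i + 2)) s : ℝ) = (i + 2 * s) / N := by
      rw [Icc.coe_convexComb, unitInterval.coe_node (by omega), unitInterval.coe_node hi]
      push_cast
      ring
    have e' : (N : ℝ) * (Icc.convexComb (node N i) (node N (i + 2)) s : unitInterval)
        = i + 2 * s := by
      rw [e]
      field_simp
    have hs0 := s.2.1
    have hs1 := s.2.2
    have h1 : (i : ℝ) ≤ N * (Icc.convexComb (node N i) (node N (i + 2)) s : unitInterval) := by
      rw [e']
      linarith
    have h2 : (N : ℝ) * (Icc.convexComb (node N i) (node N (i + 2)) s : unitInterval) ≤ i + 2 := by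
      rw [e']
      linarith
    rw [hc i hi _ h1 h2]
    congr 1
    apply Subtype.ext
    rw [hφ _ _ h1 h2, e']
    ring

/-- A locally consistent curve can be moved along with small displacements of its endpoints. -/
theorem IsLocallyConsistent.exists_deformation [CompleteSpace X] (hσ : σ.IsConvex)
    {c : unitInterval → X} (hc : σ.IsLocallyConsistent c) :
    ∃ ε > 0, (∀ t, ∃ x, closedBall (c t) ε ⊆ ball x (σ.r x)) ∧
      ∀ y z, dist y (c 0) ≤ ε → dist z (c 1) ≤ ε → ∃ c', σ.IsLocallyConsistent c' ∧
        c' 0 = y ∧ c' 1 = z ∧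
        ∀ t : unitInterval, dist (c' t) (c t) ≤ (1 - t) * dist y (c 0) + t * dist z (c 1) := by
  obtain ⟨ρ, hρ, hleb⟩ := lebesgue_number_lemma_of_metric (isCompact_range hc.1)
    (c := fun x => ball x (σ.r x)) (fun _ => isOpen_ball)
    (fun x _ => mem_iUnion.2 ⟨x, σ.mem_ball_self x⟩)
  replace hleb : ∀ t, ∃ x, ball (c t) ρ ⊆ ball x (σ.r x) := fun t => hleb _ (mem_range_self t)
  obtain ⟨η, hη, huc⟩ := Metric.uniformContinuous_iff.1
    (CompactSpace.uniformContinuous_of_continuous hc.1) (ρ / 3) (by positivity)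
  -- A block has length `2 / N < η`, so on it `c` moves by less than `ρ / 3`. Adding a displacement
  -- of at most `ρ / 3` stays within `ρ` of the left node, hence in a single ball of `σ`.
  obtain ⟨N, hN2, hNη⟩ : ∃ N : ℕ, 2 ≤ N ∧ (2 : ℝ) / N < η := by
    obtain ⟨n, hn⟩ := exists_nat_gt (2 / η)
    refine ⟨n + 2, by omega, ?_⟩
    rw [div_lt_comm₀ (by positivity) hη]
    push_cast
    linarith
  have hN0 : (0 : ℝ) < N := by
    have : 0 < N := by omega
    exact_mod_cast this
  have hsub : ∀ t, ∃ x, closedBall (c t) (ρ / 3) ⊆ ball x (σ.r x) := fun t => by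
    obtain ⟨x, hx⟩ := hleb t
    exact ⟨x, (closedBall_subset_ball (by linarith)).trans hx⟩
  refine ⟨ρ / 3, by positivity, hsub, fun y z hy hz => ?_⟩
  have hle : ∀ i, i + 2 ≤ N → node N i ≤ node N (i + 2) := by
    intro i hi
    change (node N i : ℝ) ≤ node N (i + 2)
    rw [unitInterval.coe_node (by omega), unitInterval.coe_node hi]
    push_cast
    gcongr
    linarith
  have hloc : ∀ i, i + 2 ≤ N → ∃ x, ∀ s,
      closedBall (c (Icc.convexComb (node N i) (node N (i + 2)) s)) (ρ / 3) ⊆ ball x (σ.r x) := by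
    intro i hi
    obtain ⟨x, hx⟩ := hleb (node N i)
    refine ⟨x, fun s w hw => hx ?_⟩
    have h1 : dist (Icc.convexComb (node N i) (node N (i + 2)) s) (node N i) < η := by
      refine lt_of_le_of_lt ?_ hNη
      rw [Subtype.dist_eq, Real.dist_eq, Icc.coe_convexComb, unitInterval.coe_node (by omega),
        unitInterval.coe_node hi]
      have : (1 - (s : ℝ)) * (i / N) + s * ((i + 2 : ℕ) / N) - i / N = s * (2 / N) := by
        push_cast
        ring
      rw [this, abs_of_nonneg (mul_nonneg s.2.1 (by positivity))]
      exact mul_le_of_le_one_left (by positivity) s.2.2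
    have h2 := huc h1
    have h3 := dist_triangle w (c (Icc.convexComb (node N i) (node N (i + 2)) s)) (c (node N i))
    have h4 := Metric.mem_closedBall.1 hw
    rw [Metric.mem_ball]
    linarith
  have hseg : ∀ i, i + 2 ≤ N → ∀ s, c (Icc.convexComb (node N i) (node N (i + 2)) s) =
      σ.seg (c (node N i)) (c (node N (i + 2))) s := by
    intro i hi s
    obtain ⟨x, hx⟩ := hloc i hi
    have := (hc.comp_convexComb (hle i hi)).eq_seg hσ (x := x)
      (fun t => hx t (mem_closedBall_self (by positivity))) s
    simpa using this
  have hhalf : ∀ i, i + 2 ≤ N → Icc.convexComb (node N i) (node N (i + 2)) half = node N (i + 1) := by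
    intro i hi
    apply Subtype.ext
    rw [Icc.coe_convexComb, unitInterval.coe_node (by omega), unitInterval.coe_node hi,
      unitInterval.coe_node (by omega)]
    simp only [unitInterval.coe_half]
    push_cast
    ring
  have hball : ∀ i, i + 2 ≤ N → ∃ x, closedBall (c (node N i)) (ρ / 3) ⊆ ball x (σ.r x) ∧
      closedBall (c (node N (i + 2))) (ρ / 3) ⊆ ball x (σ.r x) := by
    intro i hi
    obtain ⟨x, hx⟩ := hloc i hi
    refine ⟨x, ?_, ?_⟩
    · simpa using hx 0
    · simpa using hx 1
  obtain ⟨p, hp0, hpN, hpq, hp⟩ := hσ.exists_midpoint_chain (N := N) (by omega)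
    (q := fun i => c (node N i)) (ε := ρ / 3) (by positivity) hball
    (fun i hi => by rw [← hhalf i hi]; exact hseg i hi half) (y := y) (z := z)
    (by rwa [unitInterval.node_zero]) (by rwa [unitInterval.node_self (by omega)])
  have hdom : ∀ i, i + 2 ≤ N → (p i, p (i + 2)) ∈ localDomain σ.r := by
    intro i hi
    obtain ⟨x, hx1, hx2⟩ := hball i hi
    exact mem_localDomain (hx1 (hpq i (by omega))) (hx2 (hpq _ hi))
  obtain ⟨c', hc', hcp⟩ := exists_isLocallyConsistent_of_chain hN2 hdom hp
  have h0 : c' 0 = y := by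
    have := hcp 0 (by omega) 0
    rw [Icc.convexComb_zero, unitInterval.node_zero, σ.source _ _ (hdom 0 (by omega))] at this
    rw [this, hp0]
  have h1 : c' 1 = z := by
    have := hcp (N - 2) (by omega) 1
    rw [Icc.convexComb_one, σ.target _ _ (hdom _ (by omega)), Nat.sub_add_cancel hN2,
      unitInterval.node_self (by omega)] at this
    rw [this, hpN]
  have hnear : ∀ t, dist (c' t) (c t) ≤ ρ / 3 := by
    intro t
    obtain ⟨i, hi, s, rfl⟩ : ∃ i, i + 2 ≤ N ∧ ∃ s,
        t = Icc.convexComb (node N i) (node N (i + 2)) s := by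
      have ht0 : (0 : ℝ) ≤ N * t := mul_nonneg hN0.le t.2.1
      have htN : (N : ℝ) * t ≤ N := mul_le_of_le_one_right hN0.le t.2.2
      have key : ∃ i, i + 2 ≤ N ∧ (i : ℝ) ≤ N * t ∧ (N : ℝ) * t ≤ i + 2 := by
        rcases le_or_gt (⌊(N : ℝ) * t⌋₊ + 2) N with h | h
        · refine ⟨_, h, Nat.floor_le ht0, ?_⟩
          have := Nat.lt_floor_add_one ((N : ℝ) * t)
          linarith
        · refine ⟨N - 2, by omega, ?_, ?_⟩
          · exact le_trans (by exact_mod_cast (by omega : N - 2 ≤ ⌊(N : ℝ) * t⌋₊))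
              (Nat.floor_le ht0)
          · push_cast [hN2]
            linarith
      obtain ⟨i, hi, h1, h2⟩ := key
      refine ⟨i, hi, ⟨((N : ℝ) * t - i) / 2, by linarith, by linarith⟩, ?_⟩
      apply Subtype.ext
      rw [Icc.coe_convexComb, unitInterval.coe_node (by omega), unitInterval.coe_node hi]
      push_cast
      field_simp
      ring
    obtain ⟨x, hx1, hx2⟩ := hball i hi
    have hpos : 0 ≤ ρ / 3 := by positivity
    have h3 := hpq i (by omega)
    have h4 := hpq (i + 2) hi
    rw [hcp i hi, hseg i hi]
    refine (hσ.dist_seg_le (hx1 h3) (hx2 h4) (hx1 (mem_closedBall_self hpos))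
      (hx2 (mem_closedBall_self hpos)) s).trans ?_
    have hs0 := s.2.1
    have hs1 := s.2.2
    nlinarith
  refine ⟨c', hc', h0, h1, fun t => ?_⟩
  have := hc'.dist_le hσ hc (fun t => by
    obtain ⟨x, hx⟩ := hsub t
    exact ⟨x, hx (hnear t), hx (mem_closedBall_self (by positivity))⟩) t
  rwa [h0, h1] at this

end LocalGeodesicBicombing

/-! ### Local isometries and lifts of Lipschitz curves -/

/-- A map on `[0,1]` that is Lipschitz at each point, with the same constant, is Lipschitz. -/
theorem unitInterval.dist_le_of_local {Y : Type*} [PseudoMetricSpace Y] {f : unitInterval → Y}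
    {K : ℝ} (hf : ∀ t, ∀ᶠ s in 𝓝 t, dist (f t) (f s) ≤ K * dist t s) (s t : unitInterval) :
    dist (f s) (f t) ≤ K * dist s t := by
  wlog hst : s ≤ t generalizing s t
  · rw [dist_comm (f s), dist_comm s]
    exact this t s (le_of_not_ge hst)
  have hd : ∀ a b : unitInterval, a ≤ b → dist a b = (b : ℝ) - a := fun a b hab => by
    rw [dist_comm, Subtype.dist_eq, Real.dist_eq]
    exact abs_of_nonneg (sub_nonneg.2 hab)
  refine unitInterval.induction_local (P := fun s t => dist (f s) (f t) ≤ K * dist s t)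
    (fun a b c hab hbc h1 h2 => ?_) (fun t => ?_) hst
  · have := dist_triangle (f a) (f b) (f c)
    rw [hd a b hab] at h1
    rw [hd b c hbc] at h2
    rw [hd a c (hab.trans hbc)]
    linarith
  · filter_upwards [hf t] with s hs
    refine ⟨fun _ => ?_, fun _ => hs⟩
    rw [dist_comm (f s), dist_comm s]
    exact hs

/-- A map that maps a ball around each point isometrically onto a ball. -/
def IsLocalIsometry {E X : Type*} [MetricSpace E] [MetricSpace X] (p : E → X) : Prop :=
  ∀ c, ∃ ε > 0, (∀ a ∈ ball c ε, ∀ b ∈ ball c ε, dist (p a) (p b) = dist a b) ∧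
    ball (p c) ε ⊆ p '' ball c ε

namespace IsLocalIsometry

variable {E X : Type*} [MetricSpace E] [MetricSpace X] {p : E → X}

theorem isLocalHomeomorph (hp : IsLocalIsometry p) : IsLocalHomeomorph p := by
  rw [isLocalHomeomorph_iff_isOpenEmbedding_restrict]
  intro c
  obtain ⟨ε, hε, hiso, hsurj⟩ := hp c
  refine ⟨ball c ε, ball_mem_nhds c hε, ?_, ?_⟩
  · exact (Isometry.of_dist_eq (f := (ball c ε).domRestrict p)
      fun a b => hiso a a.2 b b.2).isEmbedding
  · have : range ((ball c ε).domRestrict p) = ball (p c) ε := by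
      rw [range_domRestrict]
      refine Subset.antisymm ?_ hsurj
      rintro _ ⟨a, ha, rfl⟩
      rw [mem_ball, hiso a ha c (mem_ball_self hε)]
      exact ha
    rw [this]
    exact isOpen_ball

theorem eq_of_lift (hp : IsLocalIsometry p) {g₁ g₂ : unitInterval → E} (h₁ : Continuous g₁)
    (h₂ : Continuous g₂) (h : ∀ t, p (g₁ t) = p (g₂ t)) (h0 : g₁ 0 = g₂ 0) : g₁ = g₂ :=
  (T2Space.isSeparatedMap p).eq_of_comp_eq hp.isLocalHomeomorph.isLocallyInjective h₁ h₂ (funext h) 0 h0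

theorem exists_local_inverse (hp : IsLocalIsometry p) (c : E) : ∃ ε > 0, ∃ s : X → E,
    ContinuousOn s (ball (p c) ε) ∧ (∀ y ∈ ball (p c) ε, p (s y) = y) ∧
      ∀ a ∈ ball c ε, s (p a) = a := by
  obtain ⟨ε, hε, hiso, hsurj⟩ := hp c
  have : ∀ y, ∃ a, y ∈ ball (p c) ε → a ∈ ball c ε ∧ p a = y := by
    intro y
    by_cases hy : y ∈ ball (p c) ε
    · obtain ⟨a, ha⟩ := hsurj hy
      exact ⟨a, fun _ => ha⟩
    · exact ⟨c, fun h => absurd h hy⟩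
  choose s hs using this
  refine ⟨ε, hε, s, ?_, fun y hy => (hs y hy).2, fun a ha => ?_⟩
  · have : LipschitzOnWith 1 s (ball (p c) ε) := LipschitzOnWith.of_dist_le_mul fun y hy z hz => by
      rw [← hiso _ (hs y hy).1 _ (hs z hz).1, (hs y hy).2, (hs z hz).2]
      simp
    exact this.continuousOn
  · have h1 : p a ∈ ball (p c) ε := by
      rw [mem_ball, hiso a ha c (mem_ball_self hε)]
      exact ha
    have h2 := hiso _ (hs _ h1).1 a ha
    rw [(hs _ h1).2, dist_self] at h2
    exact dist_eq_zero.1 h2.symm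

theorem dist_lift_le (hp : IsLocalIsometry p) {g : unitInterval → E} (hg : Continuous g) {K : ℝ}
    (hK : ∀ s t, dist (p (g s)) (p (g t)) ≤ K * dist s t) (s t : unitInterval) :
    dist (g s) (g t) ≤ K * dist s t := by
  refine unitInterval.dist_le_of_local (fun t => ?_) s t
  obtain ⟨ε, hε, hiso, -⟩ := hp (g t)
  filter_upwards [hg.continuousAt.eventually (ball_mem_nhds (g t) hε)] with s hs
  rw [← hiso _ (mem_ball_self hε) _ hs]
  exact hK t s

/-- Lipschitz curves lift through local isometries with a complete domain. -/
theorem exists_lift_of_lipschitz [CompleteSpace E] (hp : IsLocalIsometry p) {γ : unitInterval → X}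
    {K : ℝ} (hγ : ∀ s t, dist (γ s) (γ t) ≤ K * dist s t) {c : E} (hc : p c = γ 0) :
    ∃ g : unitInterval → E, Continuous g ∧ g 0 = c ∧ ∀ t, p (g t) = γ t := by
  have hK : 0 ≤ K := by
    have := dist_nonneg.trans (hγ 0 1)
    have h1 : dist (0 : unitInterval) 1 = 1 := by
      rw [Subtype.dist_eq, Real.dist_eq]
      simp
    rwa [h1, mul_one] at this
  have hγc : Continuous γ := (LipschitzWith.of_dist_le_mul (K := ⟨K, hK⟩) hγ).continuous
  have hpc := hp.isLocalHomeomorph.continuous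
  -- The times `t` such that `γ` stopped at `t` lifts. Lifts are as Lipschitz as `γ`, so their
  -- endpoints converge as the times approach `sSup S`. A local inverse at the limit point then
  -- extends a lift up to that time and past it.
  let S : Set unitInterval := {t | ∃ g : unitInterval → E, Continuous g ∧ g 0 = c ∧
    ∀ s, p (g s) = γ (min s t)}
  have h0S : (0 : unitInterval) ∈ S :=
    ⟨fun _ => c, continuous_const, rfl, fun s => by rw [hc, min_eq_right unitInterval.nonneg']⟩
  obtain ⟨u, humono, hulim, huS⟩ := exists_seq_tendsto_sSup ⟨0, h0S⟩ (OrderTop.bddAbove S)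
  have hlub := isLUB_sSup S
  set m := sSup S
  choose g hgc hg0 hg using huS
  have hcoh : ∀ n k, n ≤ k → ∀ s ≤ u n, g k s = g n s := by
    intro n k hnk s hs
    have := hp.eq_of_lift (g₁ := fun s => g k (min s (u n))) (g₂ := g n)
      ((hgc k).comp (by fun_prop)) (hgc n) (fun t => by
        rw [hg, hg, min_assoc, min_eq_left (humono hnk)]) (by
        rw [min_eq_left unitInterval.nonneg', hg0, hg0])
    have h := congrFun this s
    simpa only [min_eq_left hs] using h
  have hdist : ∀ n k, dist (g n (u n)) (g k (u k)) ≤ K * dist (u n) (u k) := by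
    intro n k
    wlog hnk : n ≤ k generalizing n k
    · rw [dist_comm, dist_comm (u n)]
      exact this k n (le_of_not_ge hnk)
    rw [← hcoh n k hnk _ le_rfl]
    refine hp.dist_lift_le (hgc k) (fun s t => ?_) _ _
    rw [hg, hg]
    refine (hγ _ _).trans (mul_le_mul_of_nonneg_left ?_ hK)
    simp only [Subtype.dist_eq, Real.dist_eq]
    exact (abs_min_sub_min_le_max (s : ℝ) (u k) t (u k)).trans (by simp)
  have hcau : CauchySeq fun n => g n (u n) := by
    rw [Metric.cauchySeq_iff]
    intro ε hε
    obtain ⟨n, hn⟩ := Metric.cauchySeq_iff.1 hulim.cauchySeq (ε / (K + 1)) (by positivity)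
    refine ⟨n, fun i hi j hj => (hdist i j).trans_lt ?_⟩
    have h1 := hn i hi j hj
    rw [lt_div_iff₀ (by positivity)] at h1
    have : 0 ≤ dist (u i) (u j) := dist_nonneg
    nlinarith
  obtain ⟨e, he⟩ := cauchySeq_tendsto_of_complete hcau
  have hpe : p e = γ m := by
    refine tendsto_nhds_unique ((hpc.tendsto e).comp he) ?_
    refine ((hγc.tendsto m).comp hulim).congr fun n => ?_
    simp only [Function.comp, hg, min_self]
  obtain ⟨ε, hε, s, hsc, hps, hsp⟩ := hp.exists_local_inverse e
  rw [hpe] at hsc hps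
  obtain ⟨δ, hδ, hball⟩ := Metric.eventually_nhds_iff_ball.1
    (hγc.continuousAt.eventually (ball_mem_nhds (γ m) hε))
  obtain ⟨n, hn1, hn2⟩ := ((he.eventually (ball_mem_nhds e hε)).and
    (hulim.eventually (ball_mem_nhds m hδ))).exists
  have hun : s (γ (u n)) = g n (u n) := by
    have := hsp _ hn1
    rwa [hg, min_self] at this
  have hext : ∀ t, u n ≤ t → t ∈ ball m δ → t ∈ S := by
    intro t hut ht
    have hin : ∀ v, γ (max (u n) (min v t)) ∈ ball (γ m) ε := by
      intro v
      refine hball _ ?_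
      have h1 : u n ≤ max (u n) (min v t) := le_max_left _ _
      have h2 : max (u n) (min v t) ≤ t := max_le hut (min_le_right _ _)
      exact (convex_ball (m : ℝ) δ).ordConnected.out hn2 ht ⟨h1, h2⟩
    refine ⟨fun v => if v ≤ u n then g n v else s (γ (max (u n) (min v t))), ?_, ?_, ?_⟩
    · refine Continuous.if_le (hgc n) ?_ continuous_id continuous_const ?_
      · exact hsc.comp_continuous (hγc.comp (by fun_prop)) hin
      · rintro v rfl
        rw [min_eq_left hut, max_self, hun]
    · exact (if_pos unitInterval.nonneg').trans (hg0 n)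
    · intro v
      beta_reduce
      split_ifs with h
      · rw [hg, min_eq_left h, min_eq_left (h.trans hut)]
      · rw [hps _ (hin v), max_eq_right (le_min (le_of_not_ge h) hut)]
  have hm1 : m = 1 := by
    by_contra hne
    have hlt : m < 1 := lt_of_le_of_ne le_top hne
    have : (𝓝[>] m).NeBot := nhdsGT_neBot_of_exists_gt ⟨1, hlt⟩
    have hev : ∀ᶠ t in 𝓝[>] m, t ∈ ball m δ := nhdsWithin_le_nhds (ball_mem_nhds m hδ)
    obtain ⟨t, ht, htm⟩ := (hev.and self_mem_nhdsWithin).exists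
    have htm : m < t := htm
    exact absurd (hlub.1 (hext t ((hlub.1 ⟨g n, hgc n, hg0 n, hg n⟩).trans htm.le) ht))
      (not_le.2 htm)
  obtain ⟨G, hG, hG0, hGp⟩ := hext m (hlub.1 ⟨g n, hgc n, hg0 n, hg n⟩) (mem_ball_self hδ)
  refine ⟨G, hG, hG0, fun t => ?_⟩
  rw [hGp, hm1, min_eq_left unitInterval.le_one']

end IsLocalIsometry

/-! ### Local isometries over a space with a convex local bicombing -/

namespace LocalGeodesicBicombing

variable {X : Type*} [MetricSpace X] {σ : LocalGeodesicBicombing X}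

theorem IsConvex.continuous_seg_prod (hσ : σ.IsConvex) {x y : X} (hy : y ∈ ball x (σ.r x)) :
    Continuous fun q : unitInterval × ball x (σ.r x) => σ.seg y q.2 q.1 := by
  refine continuous_prod_of_continuous_lipschitzWith' _ 1 (fun t => ?_) (fun z => ?_)
  · refine LipschitzWith.of_dist_le_mul fun z z' => ?_
    refine (hσ.dist_seg_le hy z.2 hy z'.2 t).trans ?_
    rw [dist_self, mul_zero, zero_add]
    exact mul_le_mul_of_nonneg_right t.2.2 dist_nonneg
  · exact (σ.isGeodesic y z (mem_localDomain hy z.2)).1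

variable {E : Type*} [MetricSpace E] [CompleteSpace E] {p : E → X}

/-- The segments from `p c` to the points of the ball are Lipschitz, so they lift to curves from
`c`; the endpoints of the lifts form the section. Joint continuity of the lifts comes from homotopy
lifting. The ball does not depend on `c`, which is what makes `p` behave like a covering. -/
theorem IsConvex.exists_section (hσ : σ.IsConvex) (hp : IsLocalIsometry p) {c : E} {x : X}
    (hc : p c ∈ ball x (σ.r x)) :
    ∃ s : ball x (σ.r x) → E, Continuous s ∧ (∀ z, p (s z) = z) ∧ s ⟨p c, hc⟩ = c := by
  have hlift : ∀ z : ball x (σ.r x), ∃ g : unitInterval → E, Continuous g ∧ g 0 = c ∧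
      ∀ t, p (g t) = σ.seg (p c) z t := fun z => by
    have d := mem_localDomain hc z.2
    refine hp.exists_lift_of_lipschitz (K := dist (p c) z) (fun s t => ?_)
      (σ.source _ _ d).symm
    rw [(σ.isGeodesic _ _ d).2 s t, σ.source _ _ d, σ.target _ _ d, mul_comm, Subtype.dist_eq,
      Real.dist_eq]
  choose g hgc hg0 hg using hlift
  have hcont : Continuous fun q : unitInterval × ball x (σ.r x) => g q.2 q.1 :=
    hp.isLocalHomeomorph.continuous_lift (T2Space.isSeparatedMap p)
      ⟨_, hσ.continuous_seg_prod hc⟩ (funext fun q => hg q.2 q.1)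
      (by simp only [hg0]; exact continuous_const) hgc
  refine ⟨fun z => g z 1, hcont.comp (by fun_prop : Continuous fun z : ball x (σ.r x) =>
    ((1 : unitInterval), z)), fun z => ?_, ?_⟩
  · rw [hg, σ.target _ _ (mem_localDomain hc z.2)]
  · have := hp.eq_of_lift (hgc ⟨p c, hc⟩) (continuous_const (y := c))
      (fun t => by rw [hg, σ.seg_self]) (hg0 _)
    exact congrFun this 1

theorem IsConvex.exists_path_lift (hσ : σ.IsConvex) (hp : IsLocalIsometry p)
    {γ : unitInterval → X} (hγ : Continuous γ) {c : E} (hc : p c = γ 0) :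
    ∃ g : C(unitInterval, E), g 0 = c ∧ ∀ t, p (g t) = γ t := by
  -- Lifts are required from every point above `γ a`, so that they can be concatenated. Clamping to
  -- `[a, b]` keeps all curves defined on the whole interval.
  let P : unitInterval → unitInterval → Prop := fun a b => ∀ c, p c = γ a →
    ∃ g : unitInterval → E, Continuous g ∧ g a = c ∧ ∀ s, p (g s) = γ (max a (min s b))
  have key : P 0 1 := by
    refine unitInterval.induction_local (fun a b d hab hbd h1 h2 c hc => ?_) (fun t => ?_) bot_le
    · obtain ⟨g₁, hg₁, hg₁a, hg₁p⟩ := h1 c hc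
      obtain ⟨g₂, hg₂, hg₂b, hg₂p⟩ := h2 (g₁ b) (by rw [hg₁p, min_self, max_eq_right hab])
      refine ⟨fun s => if s ≤ b then g₁ s else g₂ s, ?_, ?_, fun s => ?_⟩
      · refine Continuous.if_le hg₁ hg₂ continuous_id continuous_const ?_
        rintro s rfl
        exact hg₂b.symm
      · exact (if_pos hab).trans hg₁a
      · beta_reduce
        split_ifs with h
        · rw [hg₁p, min_eq_left h, min_eq_left (h.trans hbd)]
        · have h' : b ≤ min s d := le_min (le_of_not_ge h) hbd
          rw [hg₂p, max_eq_right h', max_eq_right (hab.trans h')]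
    · set x := γ t
      obtain ⟨δ, hδ, hball⟩ := Metric.eventually_nhds_iff_ball.1
        (hγ.continuousAt.eventually (isOpen_ball.mem_nhds (σ.mem_ball_self x)))
      have hP : ∀ a ∈ ball t δ, ∀ b ∈ ball t δ, a ≤ b → P a b := by
        intro a ha b hb hab c hc
        have hin : ∀ s, γ (max a (min s b)) ∈ ball x (σ.r x) := fun s => by
          refine hball _ ?_
          have h1 : a ≤ max a (min s b) := le_max_left _ _
          have h2 : max a (min s b) ≤ b := max_le hab (min_le_right _ _)
          exact (convex_ball (t : ℝ) δ).ordConnected.out ha hb ⟨h1, h2⟩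
        obtain ⟨s, hs, hps, hsc⟩ := hσ.exists_section hp (c := c) (x := x)
          (by rw [hc]; exact hball a ha)
        refine ⟨fun v => s ⟨γ (max a (min v b)), hin v⟩, ?_, ?_, fun v => hps _⟩
        · exact hs.comp (Continuous.subtype_mk (hγ.comp (by fun_prop)) _)
        · refine (congrArg s (Subtype.ext ?_)).trans hsc
          change γ _ = p c
          rw [hc, min_eq_left hab, max_self]
      filter_upwards [ball_mem_nhds t hδ] with s hs
      exact ⟨hP s hs t (Metric.mem_ball_self hδ), hP t (Metric.mem_ball_self hδ) s hs⟩
  obtain ⟨g, hg, hg0, hgp⟩ := key c hc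
  refine ⟨⟨g, hg⟩, hg0, fun t => ?_⟩
  have := hgp t
  rwa [min_eq_left unitInterval.le_one', max_eq_right unitInterval.nonneg'] at this

theorem IsConvex.bijective_of_isLocalIsometry (hσ : σ.IsConvex) [SimplyConnectedSpace X]
    [PathConnectedSpace E] (hp : IsLocalIsometry p) : Function.Bijective p := by
  obtain ⟨e₀⟩ : Nonempty E := inferInstance
  refine ⟨fun a b hab => ?_, fun y => ?_⟩
  · have hpc := hp.isLocalHomeomorph.continuous
    let A : Path e₀ a := PathConnectedSpace.somePath e₀ a
    let B : Path e₀ b := PathConnectedSpace.somePath e₀ b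
    let A' : Path (p e₀) (p a) := A.map hpc
    let B' : Path (p e₀) (p a) := (B.map hpc).cast rfl hab
    obtain ⟨H⟩ := SimplyConnectedSpace.paths_homotopic A' B'
    -- The images of `A` and `B` are homotopic with fixed ends. Lifting the homotopy slice by slice
    -- from `e₀`, monodromy keeps the endpoint of the lift fixed, so `A` and `B` end at the same
    -- point.
    have hlift : ∀ t, ∃ g : C(unitInterval, E), g 0 = e₀ ∧ ∀ s, p (g s) = H (t, s) := fun t =>
      hσ.exists_path_lift hp (γ := fun s => H (t, s)) (by fun_prop) (H.source t).symm
    choose Γ hΓ0 hΓ using hlift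
    have hmono := hp.isLocalHomeomorph.monodromy_theorem (T2Space.isSeparatedMap p) H Γ hΓ
      (fun t => by rw [hΓ0, hΓ0]) 1
    have hA : ⇑(Γ 0) = A := hp.eq_of_lift (Γ 0).continuous A.continuous (fun t => by
      rw [hΓ, H.apply_zero]; rfl) (by rw [hΓ0, A.source])
    have hB : ⇑(Γ 1) = B := hp.eq_of_lift (Γ 1).continuous B.continuous (fun t => by
      rw [hΓ, H.apply_one]; rfl) (by rw [hΓ0, B.source])
    rw [hA, hB, A.target, B.target] at hmono
    exact hmono.symm
  · let γ := PathConnectedSpace.somePath (p e₀) y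
    obtain ⟨g, -, hg⟩ := hσ.exists_path_lift hp γ.continuous (c := e₀) γ.source.symm
    exact ⟨g 1, by rw [hg, γ.target]⟩

/-! ### The space of curves from a point -/

/-- The space of locally consistent curves that start at `x`. -/
abbrev CurvesFrom (σ : LocalGeodesicBicombing X) (x : X) : Type _ :=
  {c : C(unitInterval, X) // σ.IsLocallyConsistent c ∧ c 0 = x}

/-- The endpoint of a curve. -/
def CurvesFrom.endpoint {x : X} (c : σ.CurvesFrom x) : X := c.1 1

theorem IsConvex.completeSpace_curvesFrom [CompleteSpace X] (hσ : σ.IsConvex) (x : X) :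
    CompleteSpace (σ.CurvesFrom x) := by
  refine @IsClosed.completeSpace_coe _ _ _ _ ?_
  exact hσ.isClosed_isLocallyConsistent.inter
    (isClosed_eq (continuous_eval_const 0) continuous_const)

/-- Two curves near `c` stay in common balls and start together, so their distance at time `t` is at
most `t` times that of their endpoints: the uniform distance is attained at the end. Deforming `c`
with its start fixed reaches every nearby endpoint. -/
theorem IsConvex.isLocalIsometry_endpoint [CompleteSpace X] (hσ : σ.IsConvex) (x : X) :
    IsLocalIsometry (CurvesFrom.endpoint : σ.CurvesFrom x → X) := by
  intro c
  obtain ⟨ε, hε, hsub, hdef⟩ := c.2.1.exists_deformation hσ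
  refine ⟨ε, hε, fun a ha b hb => ?_, fun y hy => ?_⟩
  · refine le_antisymm (ContinuousMap.dist_apply_le_dist (f := a.1) (g := b.1) 1) ?_
    refine (ContinuousMap.dist_le dist_nonneg).2 fun t => ?_
    have := a.2.1.dist_le hσ b.2.1 (fun t => by
      obtain ⟨z, hz⟩ := hsub t
      exact ⟨z, hz ((ContinuousMap.dist_apply_le_dist (f := a.1) (g := c.1) t).trans
        (Metric.mem_ball.1 ha).le), hz ((ContinuousMap.dist_apply_le_dist (f := b.1) (g := c.1)
          t).trans (Metric.mem_ball.1 hb).le)⟩) t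
    rw [a.2.2, b.2.2, dist_self, mul_zero, zero_add] at this
    exact this.trans (mul_le_of_le_one_left dist_nonneg t.2.2)
  · obtain ⟨c', hc', h0, h1, hd⟩ := hdef x y (by rw [c.2.2, dist_self]; exact hε.le)
      (Metric.mem_ball.1 hy).le
    refine ⟨⟨⟨c', hc'.1⟩, hc', h0⟩, ?_, h1⟩
    refine lt_of_le_of_lt ((ContinuousMap.dist_le dist_nonneg).2 fun t => ?_)
      (Metric.mem_ball.1 hy)
    refine (hd t).trans ?_
    rw [c.2.2, dist_self, mul_zero, zero_add]
    exact mul_le_of_le_one_left dist_nonneg t.2.2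

/-- Each curve `c` is joined to the constant curve through its reparametrized initial pieces. -/
theorem pathConnectedSpace_curvesFrom (σ : LocalGeodesicBicombing X) (x : X) :
    PathConnectedSpace (σ.CurvesFrom x) := by
  let e₀ : σ.CurvesFrom x := ⟨ContinuousMap.const _ x, σ.isLocallyConsistent_const x, rfl⟩
  have h : ∀ c : σ.CurvesFrom x, Joined e₀ c := by
    intro c
    let F : C(unitInterval × unitInterval, X) :=
      ⟨fun q => c.1 (Icc.convexComb 0 q.1 q.2), c.1.continuous.comp (by fun_prop)⟩
    have hF : ∀ t, σ.IsLocallyConsistent (F.curry t) ∧ F.curry t 0 = x := fun t =>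
      ⟨c.2.1.comp_convexComb bot_le, by simp [F, c.2.2]⟩
    refine ⟨⟨⟨fun t => ⟨F.curry t, hF t⟩, F.curry.continuous.subtype_mk _⟩, ?_, ?_⟩⟩
    · refine Subtype.ext (ContinuousMap.ext fun t => ?_)
      simp [F, e₀, c.2.2]
    · refine Subtype.ext (ContinuousMap.ext fun t => ?_)
      simp [F]
  exact ⟨⟨e₀⟩, fun a b => (h a).symm.trans (h b)⟩

theorem IsConvex.bijective_endpoint [CompleteSpace X] [SimplyConnectedSpace X] (hσ : σ.IsConvex)
    (x : X) : Function.Bijective (CurvesFrom.endpoint : σ.CurvesFrom x → X) := by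
  have := hσ.completeSpace_curvesFrom x
  have := σ.pathConnectedSpace_curvesFrom x
  exact hσ.bijective_of_isLocalIsometry (hσ.isLocalIsometry_endpoint x)

end LocalGeodesicBicombing

/-! ### Speed and length -/

theorem unitInterval.dist_convexComb {a b : unitInterval} (hab : a ≤ b) (u v : unitInterval) :
    dist (Icc.convexComb a b u) (Icc.convexComb a b v) = ((b : ℝ) - a) * dist u v := by
  have h : (0 : ℝ) ≤ b - a := sub_nonneg.2 hab
  have h' : ((Icc.convexComb a b u : unitInterval) : ℝ) - (Icc.convexComb a b v : unitInterval) =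
      (b - a) * (u - v) := by
    rw [Icc.coe_convexComb, Icc.coe_convexComb]
    ring
  rw [Subtype.dist_eq, Real.dist_eq, h', abs_mul, abs_of_nonneg h, Subtype.dist_eq, Real.dist_eq]

/-- The curve `c` has locally constant speed `w`. -/
def HasSpeed {X : Type*} [MetricSpace X] (c : unitInterval → X) (w : ℝ) : Prop :=
  ∀ t, ∀ᶠ p : unitInterval × unitInterval in 𝓝 (t, t), dist (c p.1) (c p.2) = w * dist p.1 p.2

namespace HasSpeed

variable {X : Type*} [MetricSpace X] {c : unitInterval → X} {w : ℝ}

theorem dist_le (h : HasSpeed c w) (s t : unitInterval) : dist (c s) (c t) ≤ w * dist s t := by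
  refine unitInterval.dist_le_of_local (fun t => ?_) s t
  have h1 : Tendsto (fun s : unitInterval => (t, s)) (𝓝 t) (𝓝 (t, t)) :=
    Continuous.tendsto' (by fun_prop) _ _ rfl
  exact (h1.eventually (h t)).mono fun s hs => hs.le

theorem nonneg (h : HasSpeed c w) : 0 ≤ w := by
  have h1 := dist_nonneg.trans (h.dist_le 0 1)
  have h2 : dist (0 : unitInterval) 1 = 1 := by
    rw [Subtype.dist_eq, Real.dist_eq]
    simp
  rwa [h2, mul_one] at h1

theorem comp_convexComb (h : HasSpeed c w) {a b : unitInterval} (hab : a ≤ b) :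
    HasSpeed (fun t => c (Icc.convexComb a b t)) (w * (b - a)) := by
  intro t
  have h1 : Tendsto (fun p : unitInterval × unitInterval =>
      (Icc.convexComb a b p.1, Icc.convexComb a b p.2)) (𝓝 (t, t))
      (𝓝 (Icc.convexComb a b t, Icc.convexComb a b t)) :=
    Continuous.tendsto' (by fun_prop) _ _ rfl
  refine (h1.eventually (h _)).mono fun p hp => ?_
  rw [hp, unitInterval.dist_convexComb hab, mul_assoc]

end HasSpeed

theorem curveLength_le_of_lipschitz {X : Type*} [MetricSpace X] {x y : X} (γ : Path x y) {K : ℝ}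
    (hγ : ∀ s t, dist (γ s) (γ t) ≤ K * dist s t) : curveLength γ ≤ ENNReal.ofReal K := by
  have hK : 0 ≤ K := by
    have h1 := dist_nonneg.trans (hγ 0 1)
    have h2 : dist (0 : unitInterval) 1 = 1 := by
      rw [Subtype.dist_eq, Real.dist_eq]
      simp
    rwa [h2, mul_one] at h1
  have hL : LipschitzWith ⟨K, hK⟩ γ := LipschitzWith.of_dist_le_mul hγ
  have h1 := hL.lipschitzOnWith (s := univ) |>.comp_eVariationOn_le (g := id) (s := univ)
    (mapsTo_univ _ _)
  have h2 : eVariationOn (id : unitInterval → unitInterval) univ = 1 := by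
    have h3 := MonotoneOn.eVariationOn_eq (f := (Subtype.val : unitInterval → ℝ)) (s := univ)
      (a := 0) (b := 1) (fun _ _ _ _ h => h) (mem_univ _) (mem_univ _)
    rw [univ_inter, ← unitInterval.univ_eq_Icc] at h3
    refine Eq.trans ?_ (h3.trans (by simp))
    rfl
  rw [Function.comp_id, h2, mul_one] at h1
  refine h1.trans_eq ?_
  rw [ENNReal.ofReal, Real.toNNReal_of_nonneg hK]
  rfl

namespace LocalGeodesicBicombing

variable {X : Type*} [MetricSpace X] {σ : LocalGeodesicBicombing X}

theorem IsLocallyConsistent.exists_local_speed {c : unitInterval → X} (hc : σ.IsLocallyConsistent c)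
    (t : unitInterval) : ∃ w, ∀ᶠ p : unitInterval × unitInterval in 𝓝 (t, t),
      dist (c p.1) (c p.2) = w * dist p.1 p.2 := by
  have hb := hc.1.continuousAt.eventually (isOpen_ball.mem_nhds (σ.mem_ball_self (c t)))
  obtain ⟨δ, hδ, hball⟩ := Metric.eventually_nhds_iff.1 ((hc.2 t).and (hb.prod_nhds hb))
  -- The `δ / 2`-neighbourhood of `t`, clamped to the unit interval. On it `c` is a single segment,
  -- hence has constant speed.
  let a : unitInterval := projIcc 0 1 zero_le_one ((t : ℝ) - δ / 2)
  let b : unitInterval := projIcc 0 1 zero_le_one ((t : ℝ) + δ / 2)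
  have ha : (a : ℝ) = max 0 (t - δ / 2) := by
    simp only [a, coe_projIcc]
    rw [min_eq_right (by linarith [t.2.2])]
  have hbv : (b : ℝ) = min 1 (t + δ / 2) := by
    simp only [b, coe_projIcc]
    exact max_eq_right (le_min zero_le_one (by linarith [t.2.1]))
  have ht0 := t.2.1
  have ht1 := t.2.2
  have hab : (a : ℝ) < b := by
    rw [ha, hbv]
    exact max_lt (lt_min zero_lt_one (by linarith)) (lt_min (by linarith) (by linarith))
  have hmem : ∀ u : unitInterval, dist u t < δ / 2 → (a : ℝ) ≤ u ∧ (u : ℝ) ≤ b := by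
    intro u hu
    rw [Subtype.dist_eq, Real.dist_eq, abs_lt] at hu
    rw [ha, hbv]
    exact ⟨max_le u.2.1 (by linarith), le_min u.2.2 (by linarith)⟩
  have habd : dist (a, b) (t, t) < δ := by
    rw [Prod.dist_eq]
    have hat : (a : ℝ) ≤ t := by rw [ha]; exact max_le ht0 (by linarith)
    have htb : (t : ℝ) ≤ b := by rw [hbv]; exact le_min ht1 (by linarith)
    have h1 : (t : ℝ) - δ / 2 ≤ a := by rw [ha]; exact le_max_right _ _
    have h2 : (b : ℝ) ≤ t + δ / 2 := by rw [hbv]; exact min_le_right _ _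
    simp only [Subtype.dist_eq, Real.dist_eq]
    exact max_lt (abs_lt.2 ⟨by linarith, by linarith⟩) (abs_lt.2 ⟨by linarith, by linarith⟩)
  obtain ⟨hseg, hda, hdb⟩ := hball habd
  have hdom := mem_localDomain hda hdb
  have hpos : (0 : ℝ) < b - a := sub_pos.2 hab
  refine ⟨dist (c a) (c b) / (b - a), ?_⟩
  have hnear := ball_mem_nhds t (half_pos hδ)
  have key : ∀ u ∈ ball t (δ / 2), ∃ s : unitInterval, (s : ℝ) = (u - a) / (b - a) ∧
      c u = σ.seg (c a) (c b) s := by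
    intro u hu
    obtain ⟨h1, h2⟩ := hmem u hu
    let s : unitInterval := ⟨((u : ℝ) - a) / (b - a), div_nonneg (by linarith) hpos.le,
      div_le_one_of_le₀ (by linarith) hpos.le⟩
    refine ⟨s, rfl, ?_⟩
    rw [← hseg (show a ≤ b from hab.le) s]
    congr 1
    apply Subtype.ext
    rw [Icc.coe_convexComb]
    simp only [s]
    field_simp
    ring
  filter_upwards [prod_mem_nhds hnear hnear] with p hp
  obtain ⟨s, hs, hcs⟩ := key p.1 hp.1
  obtain ⟨s', hs', hcs'⟩ := key p.2 hp.2
  rw [hcs, hcs', (σ.isGeodesic _ _ hdom).2, σ.source _ _ hdom, σ.target _ _ hdom, hs, hs',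
    ← sub_div, abs_div, abs_of_pos hpos, sub_sub_sub_cancel_right, Subtype.dist_eq p.1, Real.dist_eq]
  ring

theorem IsLocallyConsistent.exists_hasSpeed {c : unitInterval → X} (hc : σ.IsLocallyConsistent c) :
    ∃ w, HasSpeed c w := by
  let Q : unitInterval → ℝ → Prop := fun t w =>
    ∀ᶠ p : unitInterval × unitInterval in 𝓝 (t, t), dist (c p.1) (c p.2) = w * dist p.1 p.2
  -- No point of the unit interval is isolated, so the speed at a point is determined; speeds on
  -- adjacent intervals therefore agree.
  have huniq : ∀ t w w', Q t w → Q t w' → w = w' := by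
    intro t w w' h h'
    have h1 : Tendsto (fun s : unitInterval => (t, s)) (𝓝[≠] t) (𝓝 (t, t)) :=
      (Continuous.tendsto' (by fun_prop) _ _ rfl).mono_left nhdsWithin_le_nhds
    obtain ⟨s, ⟨hs, hs'⟩, hne⟩ :=
      ((h1.eventually (h.and h')).and (self_mem_nhdsWithin (s := {t}ᶜ))).exists
    rw [hs] at hs'
    exact mul_right_cancel₀ (dist_ne_zero.2 (Ne.symm hne)) hs'
  have key : ∃ w, ∀ t ∈ Icc (0 : unitInterval) 1, Q t w := by
    refine unitInterval.induction_local (P := fun a b => ∃ w, ∀ t ∈ Icc a b, Q t w)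
      (fun a b d hab hbd ⟨w, hw⟩ ⟨w', hw'⟩ => ?_) (fun t => ?_) bot_le
    · obtain rfl := huniq b w w' (hw b ⟨hab, le_rfl⟩) (hw' b ⟨le_rfl, hbd⟩)
      refine ⟨w, fun t ht => ?_⟩
      rcases le_total t b with h | h
      · exact hw t ⟨ht.1, h⟩
      · exact hw' t ⟨h, ht.2⟩
    · obtain ⟨w, hw⟩ := hc.exists_local_speed t
      have h1 : Tendsto (fun s : unitInterval => (s, s)) (𝓝 t) (𝓝 (t, t)) :=
        Continuous.tendsto' (by fun_prop) _ _ rfl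
      obtain ⟨δ, hδ, hball⟩ :=
        Metric.eventually_nhds_iff_ball.1 (h1.eventually hw.eventually_nhds)
      have hoc : ∀ a ∈ ball t δ, ∀ b ∈ ball t δ, ∀ u ∈ Icc a b, u ∈ ball t δ :=
        fun a ha b hb u hu => (convex_ball (t : ℝ) δ).ordConnected.out ha hb hu
      have ht := Metric.mem_ball_self (x := t) hδ
      filter_upwards [ball_mem_nhds t hδ] with s hs
      exact ⟨fun _ => ⟨w, fun u hu => hball u (hoc s hs t ht u hu)⟩,
        fun _ => ⟨w, fun u hu => hball u (hoc t ht s hs u hu)⟩⟩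
  obtain ⟨w, hw⟩ := key
  exact ⟨w, fun t => hw t ⟨unitInterval.nonneg', unitInterval.le_one'⟩⟩

theorem IsConvex.isLocalHomeomorph_endpoint [CompleteSpace X] (hσ : σ.IsConvex) (x : X) :
    IsLocalHomeomorph (CurvesFrom.endpoint : σ.CurvesFrom x → X) :=
  (hσ.isLocalIsometry_endpoint x).isLocalHomeomorph

theorem IsConsistent.isLocallyConsistent {c : unitInterval → X} (hc : Continuous c)
    (h : σ.IsConsistent c) : σ.IsLocallyConsistent c := by
  refine ⟨hc, fun t => ?_⟩
  have hb := hc.continuousAt.eventually (isOpen_ball.mem_nhds (σ.mem_ball_self (c t)))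
  filter_upwards [hb.prod_nhds hb] with p hp hle s
  exact h p.1 p.2 hle (mem_localDomain hp.1 hp.2) s

/-! ### Global curves and the induced length metric -/

section SimplyConnected

variable [CompleteSpace X] [SimplyConnectedSpace X]

theorem IsConvex.eq_of_endpoints (hσ : σ.IsConvex) {c c' : unitInterval → X}
    (hc : σ.IsLocallyConsistent c) (hc' : σ.IsLocallyConsistent c') (h0 : c 0 = c' 0)
    (h1 : c 1 = c' 1) : c = c' := by
  let e : σ.CurvesFrom (c' 0) := ⟨⟨c, hc.1⟩, hc, h0⟩
  let e' : σ.CurvesFrom (c' 0) := ⟨⟨c', hc'.1⟩, hc', rfl⟩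
  have h : e = e' := (hσ.bijective_endpoint (c' 0)).1 h1
  exact congrArg (fun e : σ.CurvesFrom (c' 0) => ⇑e.1) h

theorem IsConvex.exists_curve (hσ : σ.IsConvex) (x y : X) :
    ∃ c, σ.IsLocallyConsistent c ∧ c 0 = x ∧ c 1 = y := by
  obtain ⟨c, hc⟩ := (hσ.bijective_endpoint x).2 y
  exact ⟨c.1, c.2.1, c.2.2, hc⟩

/-- The unique locally consistent curve from `x` to `y`. -/
noncomputable def IsConvex.curve (hσ : σ.IsConvex) (x y : X) : unitInterval → X :=
  (hσ.exists_curve x y).choose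

theorem IsConvex.isLocallyConsistent_curve (hσ : σ.IsConvex) (x y : X) :
    σ.IsLocallyConsistent (hσ.curve x y) :=
  (hσ.exists_curve x y).choose_spec.1

@[simp]
theorem IsConvex.curve_zero (hσ : σ.IsConvex) (x y : X) : hσ.curve x y 0 = x :=
  (hσ.exists_curve x y).choose_spec.2.1

@[simp]
theorem IsConvex.curve_one (hσ : σ.IsConvex) (x y : X) : hσ.curve x y 1 = y :=
  (hσ.exists_curve x y).choose_spec.2.2

theorem IsLocallyConsistent.eq_curve (hσ : σ.IsConvex) {c : unitInterval → X}
    (hc : σ.IsLocallyConsistent c) : c = hσ.curve (c 0) (c 1) :=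
  hσ.eq_of_endpoints hc (hσ.isLocallyConsistent_curve _ _) (by simp) (by simp)

theorem IsConvex.curve_self (hσ : σ.IsConvex) (x : X) : hσ.curve x x = fun _ => x :=
  ((σ.isLocallyConsistent_const x).eq_curve hσ).symm

theorem IsConvex.curve_convexComb (hσ : σ.IsConvex) (x y : X) {a b : unitInterval} (hab : a ≤ b) :
    hσ.curve (hσ.curve x y a) (hσ.curve x y b) =
      fun t => hσ.curve x y (Icc.convexComb a b t) := by
  have := ((hσ.isLocallyConsistent_curve x y).comp_convexComb hab).eq_curve hσ
  simpa using this.symm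

/-- Near `(y, z)`, the curves `hσ.curve y' z'` are close to `hσ.curve y z`. -/
theorem IsConvex.exists_dist_curve_le (hσ : σ.IsConvex) (y z : X) : ∃ ε > 0, ∀ y' z',
    dist y' y ≤ ε → dist z' z ≤ ε → ∀ t : unitInterval,
      dist (hσ.curve y' z' t) (hσ.curve y z t) ≤ (1 - t) * dist y' y + t * dist z' z := by
  obtain ⟨ε, hε, -, h⟩ := (hσ.isLocallyConsistent_curve y z).exists_deformation hσ
  refine ⟨ε, hε, fun y' z' hy hz t => ?_⟩
  simp only [curve_zero, curve_one] at h
  obtain ⟨c', hc', h0, h1, hd⟩ := h y' z' hy hz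
  have := hc'.eq_curve hσ
  rw [h0, h1] at this
  rw [← this]
  exact hd t

/-- The speed of `hσ.curve x y`. -/
noncomputable def IsConvex.speed (hσ : σ.IsConvex) (x y : X) : ℝ :=
  (hσ.isLocallyConsistent_curve x y).exists_hasSpeed.choose

theorem IsConvex.hasSpeed_curve (hσ : σ.IsConvex) (x y : X) :
    HasSpeed (hσ.curve x y) (hσ.speed x y) :=
  (hσ.isLocallyConsistent_curve x y).exists_hasSpeed.choose_spec

theorem IsConvex.speed_nonneg (hσ : σ.IsConvex) (x y : X) : 0 ≤ hσ.speed x y :=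
  (hσ.hasSpeed_curve x y).nonneg

/-- Both curves start at `x`, so by the deformation estimate they are at most `s * dist z y` apart
at time `s`. For small `s` their distances from `x` are `s` times their speeds; divide by `s`. -/
theorem IsConvex.abs_speed_sub_le (hσ : σ.IsConvex) (x y : X) :
    ∀ᶠ z in 𝓝 y, |hσ.speed x z - hσ.speed x y| ≤ dist z y := by
  obtain ⟨ε, hε, h⟩ := hσ.exists_dist_curve_le x y
  filter_upwards [closedBall_mem_nhds y hε] with z hz
  have hd := h x z (by rw [dist_self]; exact hε.le) hz
  have h1 : Tendsto (fun s : unitInterval => ((0 : unitInterval), s)) (𝓝[≠] 0) (𝓝 (0, 0)) :=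
    (Continuous.tendsto' (by fun_prop) _ _ rfl).mono_left nhdsWithin_le_nhds
  obtain ⟨s, ⟨hs, hs'⟩, hne⟩ := ((h1.eventually ((hσ.hasSpeed_curve x z 0).and
    (hσ.hasSpeed_curve x y 0))).and (self_mem_nhdsWithin (s := {0}ᶜ))).exists
  have hpos : (0 : ℝ) < s := lt_of_le_of_ne s.2.1 fun h => hne (Subtype.ext h.symm)
  have hds : dist (0 : unitInterval) s = s := by
    rw [dist_comm, Subtype.dist_eq, Real.dist_eq, Icc.coe_zero, sub_zero, abs_of_pos hpos]
  simp only [curve_zero, hds] at hs hs'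
  have h2 := hd s
  rw [dist_self, mul_zero, zero_add] at h2
  have h3 := abs_dist_sub_le (hσ.curve x z s) (hσ.curve x y s) x
  rw [dist_comm _ x, dist_comm _ x, hs, hs', ← sub_mul, abs_mul, abs_of_pos hpos] at h3
  have h4 := h3.trans h2
  rw [mul_comm (s : ℝ)] at h4
  exact le_of_mul_le_mul_right h4 hpos

theorem IsConvex.speed_self (hσ : σ.IsConvex) (x : X) : hσ.speed x x = 0 := by
  have h1 : Tendsto (fun s : unitInterval => ((0 : unitInterval), s)) (𝓝[≠] 0) (𝓝 (0, 0)) :=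
    (Continuous.tendsto' (by fun_prop) _ _ rfl).mono_left nhdsWithin_le_nhds
  obtain ⟨s, hs, hne⟩ := ((h1.eventually (hσ.hasSpeed_curve x x 0)).and
    (self_mem_nhdsWithin (s := {0}ᶜ))).exists
  rw [hσ.curve_self, dist_self] at hs
  exact (mul_eq_zero.1 hs.symm).resolve_right (dist_ne_zero.2 (Ne.symm hne))

/-- Along `γ`, the speed of the curve from `x` to the moving point grows locally by at most the
distance covered, so its total growth from `0` is at most the length. -/
theorem IsConvex.speed_le_curveLength (hσ : σ.IsConvex) {x y : X} (γ : Path x y) :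
    ENNReal.ofReal (hσ.speed x y) ≤ curveLength γ := by
  have key : ENNReal.ofReal (hσ.speed x (γ 1)) ≤ ENNReal.ofReal (hσ.speed x (γ 0)) +
      eVariationOn γ (univ ∩ Icc 0 1) := by
    refine unitInterval.induction_local (P := fun a b => ENNReal.ofReal (hσ.speed x (γ b)) ≤
      ENNReal.ofReal (hσ.speed x (γ a)) + eVariationOn γ (univ ∩ Icc a b))
      (fun a b d hab hbd h1 h2 => ?_) (fun t => ?_) unitInterval.nonneg'
    · rw [← eVariationOn.Icc_add_Icc γ hab hbd (mem_univ b), ← add_assoc]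
      exact h2.trans (add_le_add_left h1 _)
    · have hstep : ∀ s u : unitInterval, ∀ a b, s ∈ Icc a b → u ∈ Icc a b →
          hσ.speed x (γ u) - hσ.speed x (γ s) ≤ dist (γ s) (γ u) →
          ENNReal.ofReal (hσ.speed x (γ u)) ≤
            ENNReal.ofReal (hσ.speed x (γ s)) + eVariationOn γ (univ ∩ Icc a b) := by
        intro s u a b hs hu h
        calc ENNReal.ofReal (hσ.speed x (γ u))
            ≤ ENNReal.ofReal (hσ.speed x (γ s) + dist (γ s) (γ u)) :=
              ENNReal.ofReal_le_ofReal (by linarith)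
          _ = ENNReal.ofReal (hσ.speed x (γ s)) + edist (γ s) (γ u) := by
              rw [ENNReal.ofReal_add (hσ.speed_nonneg _ _) dist_nonneg, edist_dist]
          _ ≤ _ := by
              gcongr
              exact eVariationOn.edist_le γ ⟨mem_univ _, hs⟩ ⟨mem_univ _, hu⟩
      filter_upwards [γ.continuous.continuousAt.eventually (hσ.abs_speed_sub_le x (γ t))] with s hs
      rw [abs_le] at hs
      refine ⟨fun hst => hstep s t s t ⟨le_rfl, hst⟩ ⟨hst, le_rfl⟩ (by linarith),
        fun hts => hstep t s t s ⟨le_rfl, hts⟩ ⟨hts, le_rfl⟩ (by rw [dist_comm]; linarith)⟩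
  rw [γ.source, γ.target, hσ.speed_self, ENNReal.ofReal_zero, zero_add] at key
  exact key.trans (eVariationOn.mono _ (subset_univ _))

theorem IsConvex.inducedLengthEDist_eq (hσ : σ.IsConvex) (x y : X) :
    inducedLengthEDist x y = ENNReal.ofReal (hσ.speed x y) := by
  refine le_antisymm ?_ (le_iInf fun γ => hσ.speed_le_curveLength γ)
  let γ : Path x y := ⟨⟨hσ.curve x y, (hσ.isLocallyConsistent_curve x y).1⟩, by simp, by simp⟩
  exact (iInf_le _ γ).trans (curveLength_le_of_lipschitz γ (hσ.hasSpeed_curve x y).dist_le)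

theorem IsConvex.toReal_inducedLengthEDist (hσ : σ.IsConvex) (x y : X) :
    (inducedLengthEDist x y).toReal = hσ.speed x y := by
  rw [hσ.inducedLengthEDist_eq, ENNReal.toReal_ofReal (hσ.speed_nonneg x y)]

theorem IsConvex.inducedLengthEDist_ne_top (hσ : σ.IsConvex) (x y : X) :
    inducedLengthEDist x y ≠ ⊤ := by
  rw [hσ.inducedLengthEDist_eq]
  exact ENNReal.ofReal_ne_top

theorem IsConvex.speed_eq (hσ : σ.IsConvex) {x y : X} {w : ℝ} (h : HasSpeed (hσ.curve x y) w) :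
    hσ.speed x y = w := by
  have h1 : Tendsto (fun s : unitInterval => ((0 : unitInterval), s)) (𝓝[≠] 0) (𝓝 (0, 0)) :=
    (Continuous.tendsto' (by fun_prop) _ _ rfl).mono_left nhdsWithin_le_nhds
  obtain ⟨s, ⟨hs, hs'⟩, hne⟩ := ((h1.eventually ((hσ.hasSpeed_curve x y 0).and (h 0))).and
    (self_mem_nhdsWithin (s := {0}ᶜ))).exists
  rw [hs] at hs'
  exact mul_right_cancel₀ (dist_ne_zero.2 (Ne.symm hne)) hs'

/-- Without reversibility the curves from `x` to `y` and from `y` to `x` may be different; their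
speeds agree because both are the induced length distance. -/
theorem IsConvex.speed_comm (hσ : σ.IsConvex) (x y : X) : hσ.speed x y = hσ.speed y x := by
  rw [← hσ.toReal_inducedLengthEDist, ← hσ.toReal_inducedLengthEDist]
  congr 1
  exact le_antisymm (inducedLengthEDist_comm_le x y) (inducedLengthEDist_comm_le y x)

theorem IsConvex.speed_curve (hσ : σ.IsConvex) (x y : X) (s t : unitInterval) :
    hσ.speed (hσ.curve x y s) (hσ.curve x y t) = |(s : ℝ) - t| * hσ.speed x y := by
  wlog hst : s ≤ t generalizing s t
  · rw [hσ.speed_comm, abs_sub_comm]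
    exact this t s (le_of_not_ge hst)
  have h := (hσ.hasSpeed_curve x y).comp_convexComb hst
  rw [← hσ.curve_convexComb x y hst] at h
  have hst' : (s : ℝ) ≤ t := hst
  rw [hσ.speed_eq h, abs_sub_comm, abs_of_nonneg (sub_nonneg.2 hst'), mul_comm]

theorem IsConvex.speed_curve_curve_le (hσ : σ.IsConvex) (x y x' y' : X) (t : unitInterval) :
    hσ.speed (hσ.curve x y t) (hσ.curve x' y' t) ≤
      (1 - t) * hσ.speed x x' + t * hσ.speed y y' := by
  set K : ℝ := (1 - t) * hσ.speed x x' + t * hσ.speed y y' with hKdef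
  have ht : (0 : ℝ) ≤ 1 - t := sub_nonneg.2 t.2.2
  have hK : 0 ≤ K :=
    add_nonneg (mul_nonneg ht (hσ.speed_nonneg _ _)) (mul_nonneg t.2.1 (hσ.speed_nonneg _ _))
  -- Slide the endpoints along the curves from `x` to `x'` and from `y` to `y'`, and follow the
  -- point at time `t`. By the deformation estimate this path is locally, hence globally,
  -- `K`-Lipschitz, so its length bounds the distance of its ends.
  let F : unitInterval → X := fun s => hσ.curve (hσ.curve x x' s) (hσ.curve y y' s) t
  have hF : ∀ s u, dist (F s) (F u) ≤ K * dist s u := by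
    refine unitInterval.dist_le_of_local fun s => ?_
    obtain ⟨ε, hε, h⟩ := hσ.exists_dist_curve_le (hσ.curve x x' s) (hσ.curve y y' s)
    filter_upwards [(hσ.isLocallyConsistent_curve x x').1.continuousAt.eventually
        (closedBall_mem_nhds _ hε), (hσ.isLocallyConsistent_curve y y').1.continuousAt.eventually
        (closedBall_mem_nhds _ hε)] with u hu hu'
    rw [dist_comm (F s), dist_comm s]
    refine (h _ _ hu hu' t).trans ?_
    have h1 := mul_le_mul_of_nonneg_left ((hσ.hasSpeed_curve x x').dist_le u s) ht
    have h2 := mul_le_mul_of_nonneg_left ((hσ.hasSpeed_curve y y').dist_le u s) t.2.1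
    rw [hKdef, add_mul]
    linarith
  have hFc : Continuous F := (LipschitzWith.of_dist_le_mul (K := ⟨K, hK⟩) hF).continuous
  let γ : Path (hσ.curve x y t) (hσ.curve x' y' t) := ⟨⟨F, hFc⟩, by simp [F], by simp [F]⟩
  have := (hσ.speed_le_curveLength γ).trans (curveLength_le_of_lipschitz γ hF)
  exact (ENNReal.ofReal_le_ofReal_iff hK).1 this

/-- Uniqueness makes the subcurve equal to the segment of `σ` even though it is not known beforehand
to stay in the ball. -/
theorem IsConvex.isConsistent_curve (hσ : σ.IsConvex) (x y : X) :
    σ.IsConsistent (hσ.curve x y) := by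
  intro a b hab hdom t
  have h1 := (isLocallyConsistent_seg hdom).eq_curve hσ
  rw [σ.source _ _ hdom, σ.target _ _ hdom, hσ.curve_convexComb x y hab] at h1
  exact (congrFun h1 t).symm

theorem IsConvex.curve_symm (hσ : σ.IsConvex) (hr : σ.IsReversible) (x y : X) (t : unitInterval) :
    hσ.curve y x t = hσ.curve x y (unitInterval.symm t) := by
  have := ((hσ.isLocallyConsistent_curve x y).symm hr).eq_curve hσ
  simp only [unitInterval.symm_zero, unitInterval.symm_one, curve_zero, curve_one] at this
  exact (congrFun this t).symm

/-- The endpoint map is a bijective local homeomorphism, so the curve from `x₀` to a point depends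
continuously on that point. Evaluating it at time `q.1` is the contraction. -/
theorem IsConvex.contractibleSpace (hσ : σ.IsConvex) : ContractibleSpace X := by
  obtain ⟨x₀⟩ : Nonempty X := inferInstance
  let e := (hσ.isLocalHomeomorph_endpoint x₀).toHomeomorphOfBijective (hσ.bijective_endpoint x₀)
  have he : ∀ x, (e.symm x).1 1 = x := fun x => e.apply_symm_apply x
  rw [contractible_iff_id_nullhomotopic]
  refine ⟨x₀, ContinuousMap.Homotopic.symm ⟨⟨⟨fun q => (e.symm q.2).1 q.1, ?_⟩, fun x => ?_,
    fun x => ?_⟩⟩⟩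
  · have h1 : Continuous fun q : unitInterval × X => (e.symm q.2).1 :=
      continuous_subtype_val.comp (e.symm.continuous.comp continuous_snd)
    exact h1.eval continuous_fst
  · exact (e.symm x).2.2
  · exact he x

end SimplyConnected

end LocalGeodesicBicombing

/-! ### The global convex bicombing -/

theorem IsGeodesic.of_dist_eq {X : Type*} [MetricSpace X] {c : unitInterval → X}
    (h : ∀ s t : unitInterval, dist (c s) (c t) = |(s : ℝ) - t| * dist (c 0) (c 1)) :
    IsGeodesic c := by
  refine ⟨(LipschitzWith.of_dist_le_mul (K := ⟨dist (c 0) (c 1), dist_nonneg⟩)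
    fun s t => ?_).continuous, h⟩
  rw [h, mul_comm]
  rfl

theorem HasConvexDist.of_dist_le {X : Type*} [MetricSpace X] {c c' : unitInterval → X}
    (h : ∀ a b s : unitInterval, a ≤ b →
      dist (c (Icc.convexComb a b s)) (c' (Icc.convexComb a b s)) ≤
        (1 - s) * dist (c a) (c' a) + s * dist (c b) (c' b)) : HasConvexDist c c' := by
  refine LinearOrder.convexOn_of_lt (convex_Icc 0 1) fun u hu v hv huv a b ha hb hab => ?_
  obtain rfl : a = 1 - b := eq_sub_of_add_eq hab
  let u' : unitInterval := ⟨u, hu⟩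
  let v' : unitInterval := ⟨v, hv⟩
  let b' : unitInterval := ⟨b, hb.le, by linarith⟩
  have e : (1 - b) • u + b • v = (Icc.convexComb u' v' b' : unitInterval) :=
    (Icc.coe_convexComb u' v' b').symm
  rw [e, IccExtend_val, IccExtend_of_mem zero_le_one _ hu, IccExtend_of_mem zero_le_one _ hv]
  exact h u' v' b' huv.le

namespace LocalGeodesicBicombing

variable {X : Type*} [MetricSpace X] {σ : LocalGeodesicBicombing X} [CompleteSpace X]
  [SimplyConnectedSpace X]

theorem IsConvex.dist_inducedLengthMetric (hσ : σ.IsConvex)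
    (h : ∀ x y : X, inducedLengthEDist x y ≠ ⊤) (x y : X) :
    @dist X (inducedLengthMetric X h).toDist x y = hσ.speed x y :=
  hσ.toReal_inducedLengthEDist x y

theorem IsConvex.isConvexGeodesicBicombing_curve (hσ : σ.IsConvex)
    (h : ∀ x y : X, inducedLengthEDist x y ≠ ⊤) :
    @IsConvexGeodesicBicombing X (inducedLengthMetric X h) hσ.curve := by
  have hd := hσ.dist_inducedLengthMetric h
  refine @IsConvexGeodesicBicombing.mk X (inducedLengthMetric X h) _
    (@IsGeodesicBicombing.mk X (inducedLengthMetric X h) _ (fun x y => ?_) hσ.curve_zero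
      hσ.curve_one ?_) (fun x y x' y' => ?_)
  · refine @IsGeodesic.of_dist_eq X (inducedLengthMetric X h) _ fun s t => ?_
    rw [hd, hd, hσ.speed_curve, hσ.curve_zero, hσ.curve_one]
  · rintro x y _ _ ⟨a, rfl⟩ ⟨b, rfl⟩ hab
    have hx : ∀ a : unitInterval, hσ.speed x (hσ.curve x y a) = a * hσ.speed x y := fun a => by
      have := hσ.speed_curve x y 0 a
      rwa [hσ.curve_zero, Icc.coe_zero, zero_sub, abs_neg, abs_of_nonneg a.2.1] at this
    rw [hd, hd, hx, hx] at hab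
    rcases le_or_gt a b with hle | hlt
    · rw [hσ.curve_convexComb x y hle]
      rintro _ ⟨t, rfl⟩
      exact mem_range_self _
    -- The distances from `x` order the parameters unless the curve has speed `0`, and then it is
    -- constant.
    · have hlt' : (b : ℝ) < a := hlt
      have h0 : hσ.speed x y = 0 := by
        have := hσ.speed_nonneg x y
        by_contra hne
        have : 0 < hσ.speed x y := lt_of_le_of_ne this (Ne.symm hne)
        nlinarith
      have hpq : hσ.curve x y a = hσ.curve x y b := by
        refine (@dist_eq_zero X (inducedLengthMetric X h) _ _).1 ?_
        rw [hd, hσ.speed_curve, h0, mul_zero]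
      rw [hpq, hσ.curve_self]
      rintro _ ⟨t, rfl⟩
      exact mem_range_self _
  · refine @HasConvexDist.of_dist_le X (inducedLengthMetric X h) _ _ fun a b s hab => ?_
    rw [hd, hd, hd]
    have := hσ.speed_curve_curve_le (hσ.curve x y a) (hσ.curve x y b) (hσ.curve x' y' a)
      (hσ.curve x' y' b) s
    rwa [hσ.curve_convexComb x y hab, hσ.curve_convexComb x' y' hab] at this

theorem IsConvex.eq_curve_of_isGeodesic (hσ : σ.IsConvex)
    (h : ∀ x y : X, inducedLengthEDist x y ≠ ⊤) {c : unitInterval → X}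
    (hc : @IsGeodesic X (inducedLengthMetric X h) c) (hcon : σ.IsConsistent c) :
    c = hσ.curve (c 0) (c 1) := by
  -- Continuity is needed for the original metric, which is bounded by the induced length metric.
  have hcont : Continuous c := by
    refine (LipschitzWith.of_dist_le_mul (K := ⟨hσ.speed (c 0) (c 1), hσ.speed_nonneg _ _⟩)
      fun s t => ?_).continuous
    have h1 : dist (c s) (c t) ≤ (inducedLengthEDist (c s) (c t)).toReal := by
      rw [dist_edist]
      exact ENNReal.toReal_mono (h _ _) (edist_le_inducedLengthEDist _ _)
    have h2 := hc.2 s t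
    rw [inducedLengthMetric_dist, hσ.dist_inducedLengthMetric] at h2
    rw [h2, mul_comm] at h1
    exact h1
  exact (IsConsistent.isLocallyConsistent hcont hcon).eq_curve hσ

end LocalGeodesicBicombing

theorem theorem1p1 {X : Type*} [MetricSpace X] [CompleteSpace X] [SimplyConnectedSpace X]
    (σ : LocalGeodesicBicombing X) (hσ : σ.IsConvex) :
    (∃ h : ∀ x y : X, inducedLengthEDist x y ≠ ⊤,
      ∃ τ : X → X → unitInterval → X,
        (@IsConvexGeodesicBicombing X (inducedLengthMetric X h) τ ∧
          ∀ x y, σ.IsConsistent (τ x y)) ∧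
        (∀ τ' : X → X → unitInterval → X,
          @IsConvexGeodesicBicombing X (inducedLengthMetric X h) τ' →
          (∀ x y, σ.IsConsistent (τ' x y)) → τ' = τ) ∧
        (σ.IsReversible → IsReversibleBicombing τ)) ∧
    ContractibleSpace X := by
  refine ⟨⟨hσ.inducedLengthEDist_ne_top, hσ.curve,
    ⟨hσ.isConvexGeodesicBicombing_curve _, hσ.isConsistent_curve⟩, fun τ' hτ' hcon => ?_,
    fun hr x y => ?_⟩, hσ.contractibleSpace⟩
  · funext x y
    have hτ := @IsConvexGeodesicBicombing.toIsGeodesicBicombing X (inducedLengthMetric X _) _ hτ'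
    have h := hσ.eq_curve_of_isGeodesic _
      (@IsGeodesicBicombing.isGeodesic X (inducedLengthMetric X _) _ hτ x y) (hcon x y)
    rwa [@IsGeodesicBicombing.source X (inducedLengthMetric X _) _ hτ,
      @IsGeodesicBicombing.target X (inducedLengthMetric X _) _ hτ] at h
  · have h : hσ.curve y x = hσ.curve x y ∘ unitInterval.symm := funext (hσ.curve_symm hr x y)
    rw [h, unitInterval.symm_bijective.surjective.range_comp]
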